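/- Let $\beta\in[0,1]$, $\rho\in(-1,1)$, $\bar\rho=\sqrt{1-\rho^2}$, and for $j\in\{0,1\}$ put $$\widetilde m_j(x,y)=\frac{1}{\bar\rho\,|x|^{\beta(1+j)}},\qquad \widetilde{\mathcal H}_j=L^2(\mathbb R^2,\widetilde m_j\,dx\,dy).$$ Consider $$\widetilde\Gamma(f_1,f_2)=|x|^{2\beta}\,\partial_xf_1\,\partial_xf_2+\rho|x|^{\beta}\left(\partial_xf_1\,\partial_yf_2+\partial_yf_1\,\partial_xf_2\right)+\partial_yf_1\,\partial_yf_2,$$ $$\widetilde{\mathcal E}_j(f_1,f_2)=\frac12\int_{\mathbb R^2}\widetilde\Gamma(f_1,f_2)\,\widetilde m_j\,dx\,dy .$$ A symmetric form on a real Hilbert space is a non-negative definite symmetric bilinear form $\mathcal E$ on a dense linear subspace $D(\mathcal E)$. It is closed if $D(\mathcal E)$ is complete for the norm $(\mathcal E(f,f)+\|f\|^2)^{1/2}$, and closable if it has a closed extension. A closed form on an $L^2$-space is a Dirichlet form if $u\in D(\mathcal E)$ implies $u^+\wedge1\in D(\mathcal E)$ and $\mathcal E(u^+\wedge1,u^+\wedge1)\le\mathcal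 E(u,u)$. The generator $\Phi(\mathcal E)$ has as its domain the set of $u\in D(\mathcal E)$ for which there is a vector $w$ with $\mathcal E(u,v)=-(w,v)$ for all $v\in D(\mathcal E)$; then $\Phi(\mathcal E)u=w$. Here $C_0^\infty(U)$ denotes the smooth functions with compact support in the open set $U$. Let $D(\widetilde{\mathcal E}_j)$ be the set of all $u\in\widetilde{\mathcal H}_j$ such that for almost every $\bar y$ the function $x\mapsto u(x,\bar y)$, and for almost every $\bar x$ the function $y\mapsto u(\bar x,y)$, has a (locally) absolutely continuous version on $\mathbb R$, and such that $\widetilde\Gamma(u,u)\in L^1(\mathbb R^2,\widetilde m_j\,dx\,dy)$, where $\partial_xu,\partial_yu$ are the derivatives of these versions. On functions of $C_0^\infty(\mathbb R^2)$ these are the classical partial derivatives. Suppose that $j=0$ and $\beta\in[0,1)$, or that $j=1$ and $\beta\in[0,\tfrac12)$. Then: (i) $(\widetilde{\mathcal E}_j,C_0^\infty(\mathbb R^2))$ is a symmetric form on $\widetilde{\mathcal H}_j$, and it is closable. (ii) $(\widetilde{\mathcal E}_j,D(\widetilde{\mathcal E}_j))$ is a Dirichlet form on $\widetilde{\mathcal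 H}_j$. Moreover, let $\mathcal S=(0,\infty)^2$ and $$\widetilde Af=\tfrac12\left(x^{2\beta}\partial_{xx}f+2\rho x^\beta\partial_{xy}f+\partial_{yy}f\right),\qquad \widetilde\Delta_gf=\tfrac{\beta}{2}x^{2\beta-1}\partial_xf+\widetilde Af .$$ Then for all $\beta\in[0,1]$, with $\Phi(\widetilde{\mathcal E}_j)$ the generator of $(\widetilde{\mathcal E}_j,D(\widetilde{\mathcal E}_j))$ as defined above: (iii) every $f_1\in C_0^\infty(\mathcal S)$ lies in the domain of $\Phi(\widetilde{\mathcal E}_0)$, $\Phi(\widetilde{\mathcal E}_0)f_1=\widetilde\Delta_gf_1$, and for all $f_1,f_2\in C_0^\infty(\mathcal S)$ $$(\Phi(\widetilde{\mathcal E}_0)f_1,f_2)_{\widetilde{\mathcal H}_0}=(\widetilde\Delta_gf_1,f_2)_{\widetilde{\mathcal H}_0}=-\widetilde{\mathcal E}_0(f_1,f_2);$$ if $\beta=0$, the same holds with $\widetilde A$ in place of $\widetilde\Delta_g$. (iv) If $\rho=0$, every $f_1\in C_0^\infty(\mathcal S)$ lies in the domain of $\Phi(\widetilde{\mathcal E}_1)$,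 $\Phi(\widetilde{\mathcal E}_1)f_1=\widetilde Af_1$, and for all $f_1,f_2\in C_0^\infty(\mathcal S)$ $$(\Phi(\widetilde{\mathcal E}_1)f_1,f_2)_{\widetilde{\mathcal H}_1}=(\widetilde Af_1,f_2)_{\widetilde{\mathcal H}_1}=-\widetilde{\mathcal E}_1(f_1,f_2).$$ -/

import Mathlib

open MeasureTheory Filter Topology

noncomputable section

namespace TimeChangedSABR

/-! ### Closed forms, Dirichlet forms and generators

A form on a real Hilbert space `H` is given by its values `E : H → H → ℝ` together with its domain
`D : Set H`; only the values of `E` on `D × D` matter. -/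

section Forms

variable {H : Type*} [NormedAddCommGroup H] [InnerProductSpace ℝ H]

/-- `(E, D)` is a symmetric form on `H`: `D` is a dense linear subspace and `E` is a non-negative
definite symmetric bilinear form on `D`. -/
structure IsSymmetricForm (E : H → H → ℝ) (D : Set H) : Prop where
  zero_mem : (0 : H) ∈ D
  add_mem : ∀ f ∈ D, ∀ g ∈ D, f + g ∈ D
  smul_mem : ∀ (a : ℝ), ∀ f ∈ D, a • f ∈ D
  dense : Dense D
  nonneg : ∀ f ∈ D, 0 ≤ E f f
  symm : ∀ f ∈ D, ∀ g ∈ D, E f g = E g f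
  smul_left : ∀ (a : ℝ), ∀ f ∈ D, ∀ g ∈ D, E (a • f) g = a * E f g
  add_left : ∀ f₁ ∈ D, ∀ f₂ ∈ D, ∀ g ∈ D, E (f₁ + f₂) g = E f₁ g + E f₂ g

/-- The norm `‖f‖_{E₁} = √(E(f,f) + ‖f‖²)`. -/
def energyNorm (E : H → H → ℝ) (f : H) : ℝ := Real.sqrt (E f f + ‖f‖ ^ 2)

/-- `(E, D)` is a closed form: a symmetric form whose domain is complete for `energyNorm E`. -/
structure IsClosedForm (E : H → H → ℝ) (D : Set H) : Prop extends IsSymmetricForm E D where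
  complete : ∀ u : ℕ → H, (∀ n, u n ∈ D) →
    (∀ ε > 0, ∃ N, ∀ m ≥ N, ∀ n ≥ N, energyNorm E (u m - u n) < ε) →
    ∃ w ∈ D, Tendsto (fun n => energyNorm E (u n - w)) atTop (𝓝 0)

/-- `(E, D)` is closable: it has a closed extension. -/
def IsClosable (E : H → H → ℝ) (D : Set H) : Prop :=
  ∃ (E' : H → H → ℝ) (D' : Set H), IsClosedForm E' D' ∧ D ⊆ D' ∧
    ∀ f ∈ D, ∀ g ∈ D, E' f g = E f g

/-- The domain of the generator of `(E, D)`: those `u ∈ D` for which `E(u, ·)` is represented on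
`D` by a vector of `H`. -/
def generatorDomain (E : H → H → ℝ) (D : Set H) : Set H :=
  {u | u ∈ D ∧ ∃ w : H, ∀ v ∈ D, E u v = -inner ℝ w v}

open Classical in
/-- The generator of `(E, D)`: for `u` in its domain, `generator E D u` is the vector `w`
(unique since `D` is dense) with `E(u, v) = -(w, v)` for all `v ∈ D`. This is the negative
self-adjoint operator corresponding to `(E, D)` when `(E, D)` is a closed form. -/
def generator (E : H → H → ℝ) (D : Set H) (u : H) : H :=
  if h : u ∈ generatorDomain E D then h.2.choose else 0

end Forms

/-- `(E, D)` is a Dirichlet form on `L²(μ)`: a closed form such that for every `u ∈ D` the function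
`u⁺ ∧ 1` belongs to `D` and has energy at most `E(u, u)`. -/
structure IsDirichletForm {X : Type*} [MeasurableSpace X] {μ : Measure X}
    (E : Lp ℝ 2 μ → Lp ℝ 2 μ → ℝ) (D : Set (Lp ℝ 2 μ)) : Prop extends IsClosedForm E D where
  markov : ∀ u ∈ D, ∃ v ∈ D, (v =ᵐ[μ] fun p => min (max (u p) 0) 1) ∧ E v v ≤ E u u

/-! ### The weighted spaces -/

/-- The density `1 / (ρ̄ |x|^{β(1+j)})`, where `ρ̄ = √(1 - ρ²)`. -/
def weight (β ρ : ℝ) (j : ℕ) (p : ℝ × ℝ) : ℝ :=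
  1 / (Real.sqrt (1 - ρ ^ 2) * |p.1| ^ (β * (1 + j)))

/-- The measure `dx dy / (ρ̄ |x|^{β(1+j)})` on the plane. -/
def weightedMeasure (β ρ : ℝ) (j : ℕ) : Measure (ℝ × ℝ) :=
  (volume : Measure (ℝ × ℝ)).withDensity fun p => ENNReal.ofReal (weight β ρ j p)

/-- The Hilbert space `L²(dx dy / (ρ̄ |x|^{β(1+j)}))`. -/
abbrev WeightedL2 (β ρ : ℝ) (j : ℕ) : Type := Lp ℝ 2 (weightedMeasure β ρ j)

/-! ### Partial derivatives along lines -/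

/-- `w` is an absolutely continuous version of `h : ℝ → ℝ`: it is absolutely continuous on each
compact interval and agrees with `h` almost everywhere. -/
def IsACVersion (h w : ℝ → ℝ) : Prop :=
  (∀ a b : ℝ, AbsolutelyContinuousOnInterval w a b) ∧ w =ᵐ[volume] h

open Classical in
/-- The absolutely continuous version of `h` (unique if it exists; `0` if there is none). -/
def acVersion (h : ℝ → ℝ) : ℝ → ℝ :=
  if H : ∃ w, IsACVersion h w then H.choose else 0

/-- `∂u/∂x`: the derivative of the absolutely continuous version of `x ↦ u(x, ȳ)`. -/
def linePartialX (u : ℝ × ℝ → ℝ) (p : ℝ × ℝ) : ℝ := deriv (acVersion fun s => u (s, p.2)) p.1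

/-- `∂u/∂y`: the derivative of the absolutely continuous version of `y ↦ u(x̄, y)`. -/
def linePartialY (u : ℝ × ℝ → ℝ) (p : ℝ × ℝ) : ℝ := deriv (acVersion fun s => u (p.1, s)) p.2

/-! ### The bilinear forms -/

/-- The quadratic expression `|x|^{2β} a₁ b₁ + 2ρ |x|^β a₁ b₂ + a₂ b₂`, symmetrized in `a, b`
(`a = (a₁, a₂)` and `b = (b₁, b₂)` are gradients at the point `p = (x, y)`). -/
def coefForm (β ρ : ℝ) (p : ℝ × ℝ) (a₁ a₂ b₁ b₂ : ℝ) : ℝ :=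
  |p.1| ^ (2 * β) * (a₁ * b₁) + ρ * |p.1| ^ β * (a₁ * b₂ + a₂ * b₁) + a₂ * b₂

/-- `Γ̃(u, v)` with the partial derivatives taken along lines. -/
def Gam (β ρ : ℝ) (u v : ℝ × ℝ → ℝ) (p : ℝ × ℝ) : ℝ :=
  coefForm β ρ p (linePartialX u p) (linePartialY u p) (linePartialX v p) (linePartialY v p)

/-- The bilinear form `Ẽ(u, v) = ½ ∫ Γ̃(u, v) dx dy / (ρ̄ |x|^{β(1+j)})`. -/
def form (β ρ : ℝ) (j : ℕ) (u v : WeightedL2 β ρ j) : ℝ :=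
  (1 / 2) * ∫ p, Gam β ρ u v p ∂(weightedMeasure β ρ j)

/-- The domain of the Dirichlet form: `u ∈ L²` such that on almost every line parallel to a
coordinate axis `u` has an absolutely continuous version, and `Γ̃(u, u) ∈ L¹`. -/
def formDomain (β ρ : ℝ) (j : ℕ) : Set (WeightedL2 β ρ j) :=
  {u | (∀ᵐ y : ℝ, ∃ w, IsACVersion (fun x => u (x, y)) w) ∧
       (∀ᵐ x : ℝ, ∃ w, IsACVersion (fun y => u (x, y)) w) ∧
       Integrable (Gam β ρ u u) (weightedMeasure β ρ j)}

/-! ### Test functions and differential operators -/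

/-- `φ ∈ C₀^∞(U)`: smooth, with compact support contained in the open set `U` of the plane. -/
structure IsTestFunction (U : Set (ℝ × ℝ)) (φ : ℝ × ℝ → ℝ) : Prop where
  smooth : ContDiff ℝ ((⊤ : ℕ∞) : WithTop ℕ∞) φ
  compact : HasCompactSupport φ
  support : tsupport φ ⊆ U

/-- The classes in `L²` of the functions of `C₀^∞(ℝ²)`. -/
def testDomain (β ρ : ℝ) (j : ℕ) : Set (WeightedL2 β ρ j) :=
  {u | ∃ φ, IsTestFunction Set.univ φ ∧ u =ᵐ[weightedMeasure β ρ j] φ}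

/-- The open quadrant `(0, ∞)²`. -/
def quadrant : Set (ℝ × ℝ) := {p | 0 < p.1 ∧ 0 < p.2}

/-- The classical partial derivative `∂φ/∂x`. -/
def dx (φ : ℝ × ℝ → ℝ) (p : ℝ × ℝ) : ℝ := deriv (fun s => φ (s, p.2)) p.1

/-- The classical partial derivative `∂φ/∂y`. -/
def dy (φ : ℝ × ℝ → ℝ) (p : ℝ × ℝ) : ℝ := deriv (fun s => φ (p.1, s)) p.2

/-- The time-changed SABR generator
`Ã f = ½ (x^{2β} ∂ₓₓ f + 2ρ x^β ∂ₓᵧ f + ∂ᵧᵧ f)`, for `f` supported in the quadrant. -/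
def opA (β ρ : ℝ) (f : ℝ × ℝ → ℝ) (p : ℝ × ℝ) : ℝ :=
  (1 / 2) * (p.1 ^ (2 * β) * dx (dx f) p + 2 * ρ * p.1 ^ β * dx (dy f) p + dy (dy f) p)

/-- The time-changed Laplace-Beltrami operator `Δ̃_g f = (β/2) x^{2β-1} ∂ₓ f + Ã f`, for `f`
supported in the quadrant. -/
def opLaplace (β ρ : ℝ) (f : ℝ × ℝ → ℝ) (p : ℝ × ℝ) : ℝ :=
  β / 2 * p.1 ^ (2 * β - 1) * dx f p + opA β ρ f p

/-- On `C₀^∞((0,∞)²)` the generator `Φ(Ẽ)` of the form coincides with the differential operator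
`L`: for test functions `f₁, f₂`, `f₁` lies in the domain of `Φ(Ẽ)`, `Φ(Ẽ) f₁ = L f₁`, and
`(Φ(Ẽ) f₁, f₂) = (L f₁, f₂) = -Ẽ(f₁, f₂)`. -/
def GeneratorMatches (β ρ : ℝ) (j : ℕ) (L : (ℝ × ℝ → ℝ) → ℝ × ℝ → ℝ) : Prop :=
  ∀ f₁ f₂ : ℝ × ℝ → ℝ, IsTestFunction quadrant f₁ → IsTestFunction quadrant f₂ →
    ∃ (h₁ : MemLp f₁ 2 (weightedMeasure β ρ j)) (h₂ : MemLp f₂ 2 (weightedMeasure β ρ j))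
      (hL : MemLp (L f₁) 2 (weightedMeasure β ρ j)),
      h₁.toLp f₁ ∈ generatorDomain (form β ρ j) (formDomain β ρ j) ∧
      generator (form β ρ j) (formDomain β ρ j) (h₁.toLp f₁) = hL.toLp (L f₁) ∧
      inner ℝ (generator (form β ρ j) (formDomain β ρ j) (h₁.toLp f₁)) (h₂.toLp f₂)
        = inner ℝ (hL.toLp (L f₁)) (h₂.toLp f₂) ∧
      inner ℝ (hL.toLp (L f₁)) (h₂.toLp f₂) = -form β ρ j (h₁.toLp f₁) (h₂.toLp f₂)

end TimeChangedSABR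

end

noncomputable section

namespace TimeChangedSABR

/-! ### Absolutely continuous versions of functions of one variable -/

/-! With `A = |x|^β ∂u/∂x` and `B = ∂u/∂y` the degenerate form gets constant coefficients: `2 Ẽ(u,
v) = (A, A') + ρ ((A, B') + (B, A')) + (B, B')` in the weighted `L²` space. Since `|ρ| < 1` this is
coercive, so the energy norm is equivalent to the graph norm of `u ↦ (A, B)`, and completeness of
the domain amounts to closedness of that gradient (`HasGradient.of_tendsto`).

Closedness is checked line by line. Along a subsequence, `L²` convergence on the plane gives `L²`
convergence on almost every line. Cauchy–Schwarz turns this into local `L¹` convergence of the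
derivatives, provided that `|x|^{-2β}` divided by the weight, a multiple of `|x|^{β(1+j)-2β}`, is
locally integrable. The limit is then an indefinite integral (`exists_isACVersion_of_tendsto`). Test
functions belong to the domain, and are dense, when the weight is locally integrable, that is when
`β(1+j) < 1`. The form on test functions is closable because the form on the full domain is a closed
extension. The Markov property is the chain rule: `u⁺ ∧ 1` has the gradient of `u` cut off to `{0 <
u < 1}`.

For the generator, the absolutely continuous versions of an arbitrary `v` in the domain are
integrated by parts against the flux of a function of `C₀^∞((0,∞)²)`. That flux vanishes near the
axis `x = 0`, so the singularity plays no role and no upper bound on `β` enters. What remains is to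
expand the weighted divergence of the flux (`generatorMatches_of_eq`).

A measurability question underlies all this: the absolutely continuous version is chosen separately
on each line, yet its derivative must be measurable on the plane (`aemeasurable_linePartialX`). -/

theorem IsACVersion.continuous {h w : ℝ → ℝ} (H : IsACVersion h w) : Continuous w := by
  refine continuous_iff_continuousAt.2 fun x => ?_
  refine (H.1 (x - 1) (x + 1)).continuousOn.continuousAt ?_
  rw [Set.uIcc_of_le (by linarith)]
  exact Icc_mem_nhds (by linarith) (by linarith)

theorem IsACVersion.unique {h w₁ w₂ : ℝ → ℝ} (H₁ : IsACVersion h w₁) (H₂ : IsACVersion h w₂) :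
    w₁ = w₂ :=
  (Continuous.ae_eq_iff_eq volume H₁.continuous H₂.continuous).1 (H₁.2.trans H₂.2.symm)

theorem IsACVersion.acVersion_eq {h w : ℝ → ℝ} (H : IsACVersion h w) : acVersion h = w := by
  have H' : ∃ w, IsACVersion h w := ⟨w, H⟩
  rw [acVersion, dif_pos H']
  exact H'.choose_spec.unique H

theorem IsACVersion.congr {h h' w : ℝ → ℝ} (H : IsACVersion h w) (e : h =ᵐ[volume] h') :
    IsACVersion h' w := ⟨H.1, H.2.trans e⟩

theorem IsACVersion.add {h₁ h₂ w₁ w₂ : ℝ → ℝ} (H₁ : IsACVersion h₁ w₁) (H₂ : IsACVersion h₂ w₂) :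
    IsACVersion (h₁ + h₂) (w₁ + w₂) :=
  ⟨fun a b => (H₁.1 a b).add (H₂.1 a b), H₁.2.add H₂.2⟩

theorem IsACVersion.const_mul {h w : ℝ → ℝ} (a : ℝ) (H : IsACVersion h w) :
    IsACVersion (fun x => a * h x) (fun x => a * w x) :=
  ⟨fun s t => (H.1 s t).const_mul a, by filter_upwards [H.2] with x hx; rw [hx]⟩

theorem IsACVersion.ae_differentiableAt {h w : ℝ → ℝ} (H : IsACVersion h w) :
    ∀ᵐ x : ℝ, DifferentiableAt ℝ w x := by
  have : ∀ n : ℕ, ∀ᵐ x : ℝ, x ∈ Set.uIcc (-(n : ℝ)) n → DifferentiableAt ℝ w x :=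
    fun n => (H.1 _ _).ae_differentiableAt
  filter_upwards [ae_all_iff.2 this] with x hx
  obtain ⟨n, hn⟩ := exists_nat_ge |x|
  refine hx n ?_
  rw [Set.uIcc_of_le (by linarith [abs_nonneg x])]
  exact abs_le.1 hn

theorem isACVersion_of_contDiff {w : ℝ → ℝ} (hw : ContDiff ℝ 1 w) : IsACVersion w w :=
  ⟨fun _ _ => hw.contDiffOn.absolutelyContinuousOnInterval, ae_eq_rfl⟩

/-! ### The unit contraction and limits of absolutely continuous functions. -/

/-- The unit contraction `t ↦ t⁺ ∧ 1`. -/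
def unitContraction (t : ℝ) : ℝ := min (max t 0) 1

theorem lipschitzWith_unitContraction : LipschitzWith 1 unitContraction :=
  (LipschitzWith.id.max_const 0).min_const 1

theorem IsACVersion.unitContraction_comp {h w : ℝ → ℝ} (H : IsACVersion h w) :
    IsACVersion (unitContraction ∘ h) (unitContraction ∘ w) := by
  refine ⟨fun a b => ?_, ?_⟩
  · refine squeeze_zero (fun t => ?_) (fun t => ?_) (H.1 a b)
    · exact Finset.sum_nonneg fun i _ => dist_nonneg
    · refine Finset.sum_le_sum fun i _ => ?_
      simpa using lipschitzWith_unitContraction.dist_le_mul (w (t.2 i).1) (w (t.2 i).2)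
  · filter_upwards [H.2] with x hx
    simp [hx]

theorem unitContraction_mem (t : ℝ) : 0 ≤ unitContraction t ∧ unitContraction t ≤ 1 := by
  simp [unitContraction]

/-- Where `w` is outside `(0, 1)` the composition attains its global minimum `0` or maximum `1`, so
`deriv` is `0` there, by Fermat's rule or, at a kink, by default. Hence the formula holds at every
point. -/
theorem deriv_unitContraction_comp {w : ℝ → ℝ} (hw : Continuous w) (x : ℝ) :
    deriv (unitContraction ∘ w) x = (w ⁻¹' Set.Ioo 0 1).indicator (deriv w) x := by
  by_cases hx : x ∈ w ⁻¹' Set.Ioo 0 1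
  · rw [Set.indicator_of_mem hx]
    refine Filter.EventuallyEq.deriv_eq ?_
    filter_upwards [(isOpen_Ioo.preimage hw).mem_nhds hx] with z hz
    have h1 := hz.1
    have h2 := hz.2
    simp [unitContraction, h1.le, h2.le]
  · rw [Set.indicator_of_notMem hx]
    rcases le_or_gt (w x) 0 with h | h
    · refine IsLocalMin.deriv_eq_zero (Eventually.of_forall fun z => ?_)
      have : unitContraction (w x) = 0 := by simp [unitContraction, h]
      simpa [this] using (unitContraction_mem (w z)).1
    · have h1 : 1 ≤ w x := by
        by_contra h2
        exact hx ⟨h, not_le.1 h2⟩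
      refine IsLocalMax.deriv_eq_zero (Eventually.of_forall fun z => ?_)
      have : unitContraction (w x) = 1 := by simp [unitContraction, h1]
      simpa [this] using (unitContraction_mem (w z)).2

/-- Closedness of `d/dx` with derivatives converging in local `L¹`: convergence at one point `x₀`
and of the derivatives forces `w n` to converge to `h x₀ + ∫ g`. -/
theorem exists_isACVersion_of_tendsto {w : ℕ → ℝ → ℝ} {h g : ℝ → ℝ}
    (hw : ∀ n a b, AbsolutelyContinuousOnInterval (w n) a b) (hg : Measurable g)
    (hd : ∀ R : ℝ, Tendsto (fun n => ∫⁻ x in Set.Icc (-R) R, ‖deriv (w n) x - g x‖ₑ)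
      atTop (𝓝 0))
    (hh : ∀ᵐ x : ℝ, Tendsto (fun n => w n x) atTop (𝓝 (h x))) :
    ∃ v, IsACVersion h v ∧ deriv v =ᵐ[volume] g := by
  have hint : ∀ R : ℝ, IntegrableOn g (Set.Icc (-R) R) := by
    intro R
    -- One index at finite `L¹` distance suffices: `g` is then a difference of two integrable
    -- functions.
    obtain ⟨n, hn⟩ := ((hd R).eventually (gt_mem_nhds one_pos)).exists
    have h1 : IntegrableOn (fun x => deriv (w n) x - g x) (Set.Icc (-R) R) :=
      ⟨((measurable_deriv _).sub hg).aestronglyMeasurable, hn.trans ENNReal.one_lt_top⟩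
    have h2 : IntegrableOn (deriv (w n)) (Set.Icc (-R) R) := by
      rcases le_total (-R) R with hR | hR
      · have := (hw n (-R) R).intervalIntegrable_deriv
        rwa [intervalIntegrable_iff_integrableOn_Icc_of_le hR] at this
      · refine IntegrableOn.mono_set (t := {R}) (by simp) fun x hx => ?_
        exact le_antisymm hx.2 (hR.trans hx.1)
    refine (h2.sub h1).congr_fun (fun x _ => ?_) measurableSet_Icc
    simp
  have hsub : ∀ a b : ℝ, Set.uIcc a b ⊆ Set.Icc (-(max |a| |b|)) (max |a| |b|) := by
    intro a b
    refine Set.uIcc_subset_Icc ?_ ?_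
    · exact abs_le.1 (le_max_left _ _)
    · exact abs_le.1 (le_max_right _ _)
  have hgi : ∀ a b : ℝ, IntervalIntegrable g volume a b := fun a b =>
    ((hint _).mono_set (hsub a b)).intervalIntegrable
  obtain ⟨x₀, hx₀⟩ := hh.exists
  set v : ℝ → ℝ := fun x => h x₀ + ∫ t in x₀..x, g t with hv
  have hlim : ∀ x, Tendsto (fun n => w n x) atTop (𝓝 (v x)) := by
    intro x
    have e : ∀ n, w n x = w n x₀ + ((∫ t in x₀..x, (deriv (w n) t - g t)) + ∫ t in x₀..x, g t) := by
      intro n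
      rw [intervalIntegral.integral_sub (hw n x₀ x).intervalIntegrable_deriv (hgi x₀ x),
        (hw n x₀ x).integral_deriv_eq_sub]
      ring
    simp_rw [e]
    refine hx₀.add ?_
    conv => rhs; rw [← zero_add (∫ t in x₀..x, g t)]
    refine Tendsto.add_const _ ?_
    rw [tendsto_zero_iff_enorm_tendsto_zero]
    refine tendsto_of_tendsto_of_tendsto_of_le_of_le tendsto_const_nhds
      (hd (max |x₀| |x|)) (fun _ => zero_le) fun n => ?_
    have : ‖∫ t in x₀..x, (deriv (w n) t - g t)‖ₑ
        = ‖∫ t in Set.uIoc x₀ x, (deriv (w n) t - g t)‖ₑ := by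
      rw [← ofReal_norm, ← ofReal_norm, intervalIntegral.norm_intervalIntegral_eq]
    simp only [this]
    refine (enorm_integral_le_lintegral_enorm _).trans ?_
    exact lintegral_mono_set (Set.uIoc_subset_uIcc.trans (hsub _ _))
  refine ⟨v, ⟨fun a b => ?_, ?_⟩, ?_⟩
  -- The interval is enlarged to contain the base point `x₀`, then restricted.
  · have h1 : AbsolutelyContinuousOnInterval (fun x => ∫ t in x₀..x, g t)
        (-(max (max |a| |b|) |x₀|)) (max (max |a| |b|) |x₀|) := by
      refine (hgi _ _).absolutelyContinuousOnInterval_intervalIntegral ?_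
      rw [Set.uIcc_of_le (neg_le_self (le_max_of_le_right (abs_nonneg x₀)))]
      exact abs_le.1 (le_max_right _ _)
    have h2 : AbsolutelyContinuousOnInterval (fun x => ∫ t in x₀..x, g t) a b := by
      refine h1.mono ?_
      rw [Set.uIcc_of_le (neg_le_self (le_max_of_le_right (abs_nonneg x₀)))]
      refine (hsub a b).trans (Set.Icc_subset_Icc ?_ ?_) <;> simp
    have h3 : AbsolutelyContinuousOnInterval (fun _ : ℝ => h x₀) a b :=
      contDiff_const.contDiffOn.absolutelyContinuousOnInterval
    exact h3.add h2
  · filter_upwards [hh] with x hx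
    exact tendsto_nhds_unique (hlim x) hx
  · have : LocallyIntegrable g := by
      refine fun x => ⟨Set.Icc (-(|x| + 1)) (|x| + 1), Icc_mem_nhds ?_ ?_, hint _⟩
      · linarith [neg_abs_le x]
      · linarith [le_abs_self x]
    filter_upwards [LocallyIntegrable.ae_hasDerivAt_integral this] with x hx
    exact ((hx x₀).const_add (h x₀)).deriv

/-! ### Measurability of partial derivatives along lines -/

/-- The compact-open topology has the subbasis `{f | f(K) ⊆ U}`. By compactness, `f(K) ⊆ U` means
that the distance from `f` to `Uᶜ` is bounded below on `K`, and by continuity a countable dense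
subset of `K` decides this. -/
theorem measurable_continuousMap_of_eval {Y : Type*} [MeasurableSpace Y] {F : Y → C(ℝ, ℝ)}
    (hF : ∀ x, Measurable fun y => F y x) : Measurable[_, borel C(ℝ, ℝ)] F := by
  rw [borel_eq_generateFrom_of_subbasis (ContinuousMap.compactOpen_eq (X := ℝ) (Y := ℝ))]
  refine measurable_generateFrom ?_
  rintro _ ⟨K, hK, U, hU, rfl⟩
  have hK : IsCompact K := hK
  have hU : IsOpen U := hU
  obtain ⟨D, hDK, hDc, hKD⟩ :=
    (TopologicalSpace.IsSeparable.of_separableSpace K).exists_countable_dense_subset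
  have key : F ⁻¹' {f | Set.MapsTo f K U}
      = ⋃ n : ℕ, ⋂ q ∈ D, {y | ((n : ENNReal) + 1)⁻¹ ≤ Metric.infEDist (F y q) Uᶜ} := by
    ext y
    simp only [Set.mem_preimage, Set.mem_ofPred_eq, Set.mem_iUnion, Set.mem_iInter]
    have hc : Continuous fun x => Metric.infEDist (F y x) Uᶜ :=
      Metric.continuous_infEDist.comp (F y).continuous
    constructor
    · intro hy
      rcases K.eq_empty_or_nonempty with rfl | hne
      · exact ⟨0, fun q hq => absurd (hDK hq) (Set.notMem_empty q)⟩
      obtain ⟨x, hxK, hx⟩ := hK.exists_isMinOn hne hc.continuousOn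
      have hpos : Metric.infEDist (F y x) Uᶜ ≠ 0 := by
        intro h0
        have := Metric.mem_closure_iff_infEDist_zero.2 h0
        rw [hU.isClosed_compl.closure_eq] at this
        exact this (hy hxK)
      obtain ⟨n, hn⟩ := ENNReal.exists_inv_nat_lt hpos
      refine ⟨n, fun q hq => le_trans ?_ (hx (hDK hq))⟩
      exact (ENNReal.inv_le_inv.2 le_self_add).trans hn.le
    · rintro ⟨n, hn⟩ x hx
      have hcl : IsClosed {x | ((n : ENNReal) + 1)⁻¹ ≤ Metric.infEDist (F y x) Uᶜ} :=
        isClosed_le continuous_const hc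
      have hx' := (closure_minimal (fun q hq => hn q hq) hcl) (hKD hx)
      by_contra hxU
      have h0 : Metric.infEDist (F y x) Uᶜ = 0 := Metric.infEDist_zero_of_mem hxU
      have h1 : ((n : ENNReal) + 1)⁻¹ ≤ 0 := h0 ▸ hx'
      simp at h1
  rw [key]
  refine MeasurableSet.iUnion fun n => MeasurableSet.biInter hDc fun q _ => ?_
  exact measurableSet_le measurable_const (Metric.continuous_infEDist.measurable.comp (hF q))

/-- Averages see only the almost everywhere class, so this recovers each value of a continuous
version from the original function. -/
theorem tendsto_mul_setIntegral_Ioc {w : ℝ → ℝ} (hw : Continuous w) (x : ℝ) :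
    Tendsto (fun n : ℕ => ((n : ℝ) + 1) * ∫ s in Set.Ioc x (x + ((n : ℝ) + 1)⁻¹), w s)
      atTop (𝓝 (w x)) := by
  have h1 : HasDerivAt (fun t => ∫ s in x..t, w s) (w x) x :=
    intervalIntegral.integral_hasDerivAt_right (hw.intervalIntegrable _ _)
      (hw.stronglyMeasurableAtFilter _ _) hw.continuousAt
  have h2 := h1.tendsto_slope_zero_right
  have h3 : Tendsto (fun n : ℕ => ((n : ℝ) + 1)⁻¹) atTop (𝓝[>] 0) := by
    refine tendsto_nhdsWithin_iff.2 ⟨?_, Eventually.of_forall fun n => ?_⟩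
    · simpa using tendsto_one_div_add_atTop_nhds_zero_nat (𝕜 := ℝ)
    · exact Set.mem_Ioi.2 (by positivity)
  refine (h2.comp h3).congr fun n => ?_
  have : x ≤ x + ((n : ℝ) + 1)⁻¹ := by
    have : 0 ≤ ((n : ℝ) + 1)⁻¹ := by positivity
    linarith
  simp [intervalIntegral.integral_of_le this]

/-- The version on the line at height `y` is regarded as a point of `C(ℝ, ℝ)` depending measurably
on `y`; differentiation is jointly measurable in the function and the point. -/
theorem aemeasurable_linePartialX {u : ℝ × ℝ → ℝ} (hu : StronglyMeasurable u)
    (h : ∀ᵐ y : ℝ, ∃ w, IsACVersion (fun x => u (x, y)) w) :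
    AEMeasurable (linePartialX u) := by
  obtain ⟨N, hN, hNm, hN0⟩ := exists_measurable_superset_of_null (ae_iff.1 h)
  have hT : ∀ y, y ∉ N → ∃ w, IsACVersion (fun x => u (x, y)) w := by
    intro y hy
    by_contra hc
    exact hy (hN hc)
  have hV : ∀ y, y ∉ N → IsACVersion (fun x => u (x, y)) (acVersion fun x => u (x, y)) := by
    intro y hy
    obtain ⟨w, hw⟩ := hT y hy
    rwa [hw.acVersion_eq]
  classical
  let F : ℝ → C(ℝ, ℝ) := fun y =>
    if hy : y ∈ N then 0 else ⟨acVersion fun x => u (x, y), (hV y hy).continuous⟩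
  have hF : ∀ y, y ∉ N → (F y : ℝ → ℝ) = acVersion fun x => u (x, y) := by
    intro y hy
    simp only [F, dif_neg hy]
    rfl
  have hFm : ∀ x, Measurable fun y => F y x := by
    intro x
    -- The value at `x` is a limit of averages of `u` over short intervals, which are measurable in
    -- `y` by Fubini.
    refine measurable_of_tendsto_metrizable (f := fun (n : ℕ) => Nᶜ.indicator fun y =>
      ((n : ℝ) + 1) * ∫ s in Set.Ioc x (x + ((n : ℝ) + 1)⁻¹), u (s, y)) (fun n => ?_) ?_
    · refine Measurable.indicator (Measurable.const_mul ?_ _) hNm.compl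
      have : StronglyMeasurable fun p : ℝ × ℝ => u p.swap := hu.comp_measurable measurable_swap
      exact (this.integral_prod_right' (ν := volume.restrict _)).measurable
    · refine tendsto_pi_nhds.2 fun y => ?_
      by_cases hy : y ∈ N
      · simp [F, hy]
      · simp only [Set.indicator_of_mem (Set.mem_compl hy)]
        rw [hF y hy]
        refine (tendsto_mul_setIntegral_Ioc (hV y hy).continuous x).congr fun n => ?_
        congr 1
        refine integral_congr_ae (ae_restrict_of_ae ?_)
        exact (hV y hy).2
  borelize C(ℝ, ℝ)
  have hFmeas : Measurable F := measurable_continuousMap_of_eval hFm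
  have hD : Measurable fun p : C(ℝ, ℝ) × ℝ => deriv p.1 p.2 :=
    measurable_deriv_with_param (f := fun (f : C(ℝ, ℝ)) (x : ℝ) => f x) continuous_eval
  refine ⟨fun p => deriv (F p.2) p.1,
    hD.comp ((hFmeas.comp measurable_snd).prodMk measurable_fst), ?_⟩
  have : ∀ᵐ y : ℝ, y ∉ N := by simpa [ae_iff] using hN0
  have := (Measure.quasiMeasurePreserving_snd (μ := (volume : Measure ℝ))
    (ν := (volume : Measure ℝ))).ae this
  filter_upwards [this] with p hp
  rw [hF p.2 hp]
  rfl

/-! ### Almost everywhere statements on the plane and on lines -/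

theorem ae_ae_swap {P : ℝ × ℝ → Prop} (h : ∀ᵐ p : ℝ × ℝ, P p) : ∀ᵐ y : ℝ, ∀ᵐ x : ℝ, P (x, y) := by
  have h' : ∀ᵐ p : ℝ × ℝ, P p.swap :=
    (Measure.measurePreserving_swap (μ := (volume : Measure ℝ))
      (ν := (volume : Measure ℝ))).quasiMeasurePreserving.ae h
  exact Measure.ae_ae_of_ae_prod h'

theorem ae_swap {P : ℝ × ℝ → Prop} (h : ∀ᵐ p : ℝ × ℝ, P p) : ∀ᵐ p : ℝ × ℝ, P p.swap :=
  (Measure.measurePreserving_swap (μ := (volume : Measure ℝ))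
      (ν := (volume : Measure ℝ))).quasiMeasurePreserving.ae h

theorem ae_of_ae_ae_swap {P : ℝ × ℝ → Prop} (hP : MeasurableSet {p | P p})
    (h : ∀ᵐ y : ℝ, ∀ᵐ x : ℝ, P (x, y)) : ∀ᵐ p : ℝ × ℝ, P p := by
  have h' : ∀ᵐ p : ℝ × ℝ, P p.swap :=
    (Measure.ae_prod_iff_ae_ae (measurable_swap hP)).2 h
  simpa using ae_swap h'

/-- Equality on almost every line passes to the plane only for measurable sets, hence the measurable
representatives. -/
theorem ae_eq_of_ae_ae_eq {f g : ℝ × ℝ → ℝ} (hf : AEMeasurable f) (hg : AEMeasurable g)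
    (h : ∀ᵐ y : ℝ, ∀ᵐ x : ℝ, f (x, y) = g (x, y)) : f =ᵐ[volume] g := by
  have h' : ∀ᵐ p : ℝ × ℝ, hf.mk f p = hg.mk g p := by
    refine ae_of_ae_ae_swap (measurableSet_eq_fun hf.measurable_mk hg.measurable_mk) ?_
    filter_upwards [h, ae_ae_swap hf.ae_eq_mk, ae_ae_swap hg.ae_eq_mk] with y h1 h2 h3
    filter_upwards [h1, h2, h3] with x h1 h2 h3
    rw [← h2, ← h3, h1]
  filter_upwards [h', hf.ae_eq_mk, hg.ae_eq_mk] with p h1 h2 h3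
  rw [h2, h3, h1]

/-! ### Weighted partial derivatives along lines -/

/-- On almost every horizontal line `u` has an absolutely continuous version `w`, and `c w' = A`
almost everywhere on that line. -/
def HasLinePartial (c u A : ℝ × ℝ → ℝ) : Prop :=
  ∀ᵐ y : ℝ, ∃ w, IsACVersion (fun x => u (x, y)) w ∧ ∀ᵐ x : ℝ, c (x, y) * deriv w x = A (x, y)

namespace HasLinePartial

variable {c u u' A A' : ℝ × ℝ → ℝ}

theorem congr (H : HasLinePartial c u A) (hu : u =ᵐ[volume] u') (hA : A =ᵐ[volume] A') :
    HasLinePartial c u' A' := by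
  filter_upwards [H, ae_ae_swap hu, ae_ae_swap hA] with y ⟨w, hw, hd⟩ h1 h2
  refine ⟨w, hw.congr h1, ?_⟩
  filter_upwards [hd, h2] with x h3 h4
  rw [h3, h4]

theorem add (H : HasLinePartial c u A) (H' : HasLinePartial c u' A') :
    HasLinePartial c (u + u') (A + A') := by
  filter_upwards [H, H'] with y ⟨w, hw, hd⟩ ⟨w', hw', hd'⟩
  refine ⟨w + w', hw.add hw', ?_⟩
  filter_upwards [hd, hd', hw.ae_differentiableAt, hw'.ae_differentiableAt] with x h1 h2 h3 h4
  rw [deriv_add h3 h4, mul_add, h1, h2]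
  rfl

theorem const_mul (a : ℝ) (H : HasLinePartial c u A) :
    HasLinePartial c (fun p => a * u p) (fun p => a * A p) := by
  filter_upwards [H] with y ⟨w, hw, hd⟩
  refine ⟨_, hw.const_mul a, ?_⟩
  filter_upwards [hd] with x h1
  rw [deriv_const_mul_field, ← h1]
  ring

theorem unitContraction_comp (H : HasLinePartial c u A) :
    HasLinePartial c (unitContraction ∘ u) ((u ⁻¹' Set.Ioo 0 1).indicator A) := by
  filter_upwards [H] with y ⟨w, hw, hd⟩
  refine ⟨_, hw.unitContraction_comp, ?_⟩
  filter_upwards [hd, hw.2] with x h1 h2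
  rw [deriv_unitContraction_comp hw.continuous]
  by_cases hx : (x, y) ∈ u ⁻¹' Set.Ioo 0 1
  · have hx' : x ∈ w ⁻¹' Set.Ioo 0 1 := by simpa [h2] using hx
    rw [Set.indicator_of_mem hx, Set.indicator_of_mem hx', h1]
  · have hx' : x ∉ w ⁻¹' Set.Ioo 0 1 := by simpa [h2] using hx
    rw [Set.indicator_of_notMem hx, Set.indicator_of_notMem hx', mul_zero]

theorem exists_isACVersion (H : HasLinePartial c u A) :
    ∀ᵐ y : ℝ, ∃ w, IsACVersion (fun x => u (x, y)) w := by
  filter_upwards [H] with y ⟨w, hw, _⟩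
  exact ⟨w, hw⟩

theorem mul_linePartialX (H : HasLinePartial c u A) (hu : StronglyMeasurable u)
    (hc : Measurable c) (hA : Measurable A) :
    (fun p => c p * linePartialX u p) =ᵐ[volume] A := by
  refine ae_eq_of_ae_ae_eq
    (hc.aemeasurable.mul (aemeasurable_linePartialX hu H.exists_isACVersion)) hA.aemeasurable ?_
  filter_upwards [H] with y ⟨w, hw, hd⟩
  filter_upwards [hd] with x h1
  rw [← h1, linePartialX, hw.acVersion_eq]

theorem of_exists_isACVersion (h : ∀ᵐ y : ℝ, ∃ w, IsACVersion (fun x => u (x, y)) w) :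
    HasLinePartial c u fun p => c p * linePartialX u p := by
  filter_upwards [h] with y ⟨w, hw⟩
  refine ⟨w, hw, Eventually.of_forall fun x => ?_⟩
  rw [linePartialX, hw.acVersion_eq]

end HasLinePartial

/-! ### Closedness of weighted line derivatives. -/

theorem lintegral_mul_le_sqrt_mul_sqrt {α : Type*} [MeasurableSpace α] (μ : Measure α)
    {f g W : α → ENNReal} (hf : Measurable f) (hg : Measurable g) (hW : Measurable W)
    (hW0 : ∀ᵐ x ∂μ, W x ≠ 0) (hW1 : ∀ᵐ x ∂μ, W x ≠ ⊤) :
    ∫⁻ x, f x * g x ∂μ ≤ (∫⁻ x, f x ^ 2 * W x ∂μ) ^ (1 / 2 : ℝ) *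
      (∫⁻ x, g x ^ 2 * (W x)⁻¹ ∂μ) ^ (1 / 2 : ℝ) := by
  have h2 : ∀ a b : ENNReal, (a * b ^ (1 / 2 : ℝ)) ^ (2 : ℝ) = a ^ 2 * b := by
    intro a b
    rw [ENNReal.mul_rpow_of_nonneg _ _ (by norm_num), ← ENNReal.rpow_mul]
    norm_num
  have h := ENNReal.lintegral_mul_le_Lp_mul_Lq μ (Real.HolderConjugate.two_two)
    (f := fun x => f x * (W x) ^ (1 / 2 : ℝ)) (g := fun x => g x * (W x)⁻¹ ^ (1 / 2 : ℝ))
    (hf.mul (hW.pow_const _)).aemeasurable (hg.mul (hW.inv.pow_const _)).aemeasurable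
  simp only [h2] at h
  refine le_trans (le_of_eq (lintegral_congr_ae ?_)) h
  filter_upwards [hW0, hW1] with x h0 h1
  have : (W x) ^ (1 / 2 : ℝ) * (W x)⁻¹ ^ (1 / 2 : ℝ) = 1 := by
    rw [← ENNReal.mul_rpow_of_nonneg _ _ (by norm_num), ENNReal.mul_inv_cancel h0 h1,
      ENNReal.one_rpow]
  simp only [Pi.mul_apply]
  rw [mul_mul_mul_comm, this, mul_one]

/-- Summability gives, by Tonelli, pointwise convergence of `U n` almost everywhere and weighted
`L²` convergence of `V n` on almost every line. Since `w' = c⁻¹ V`, Cauchy–Schwarz with `hloc` makes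
the derivatives converge in local `L¹`. -/
theorem HasLinePartial.of_tsum_ne_top {c u A : ℝ × ℝ → ℝ} {W : ℝ × ℝ → ENNReal}
    {U V : ℕ → ℝ × ℝ → ℝ} (hc : Measurable c) (hu : Measurable u) (hA : Measurable A)
    (hW : Measurable W) (hUm : ∀ n, Measurable (U n)) (hVm : ∀ n, Measurable (V n))
    (hc0 : ∀ᵐ p, c p ≠ 0) (hW0 : ∀ᵐ p, W p ≠ 0) (hW1 : ∀ p, W p ≠ ⊤)
    (hloc : ∀ᵐ y : ℝ, ∀ R : ℝ,
      ∫⁻ x in Set.Icc (-R) R, ‖(c (x, y))⁻¹‖ₑ ^ 2 * (W (x, y))⁻¹ ≠ ⊤)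
    (H : ∀ n, HasLinePartial c (U n) (V n))
    (hU : ∑' n, ∫⁻ p, ‖U n p - u p‖ₑ ^ 2 * W p ≠ ⊤)
    (hV : ∑' n, ∫⁻ p, ‖V n p - A p‖ₑ ^ 2 * W p ≠ ⊤) : HasLinePartial c u A := by
  have hVA : ∀ n, Measurable fun p => ‖V n p - A p‖ₑ ^ 2 * W p := fun n =>
    (((hVm n).sub hA).enorm.pow_const 2).mul hW
  have hUu : ∀ n, Measurable fun p => ‖U n p - u p‖ₑ ^ 2 * W p := fun n =>
    (((hUm n).sub hu).enorm.pow_const 2).mul hW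
  have hUlim : ∀ᵐ p, Tendsto (fun n => U n p) atTop (𝓝 (u p)) := by
    rw [← lintegral_tsum fun n => (hUu n).aemeasurable] at hU
    filter_upwards [ae_lt_top (Measurable.tsum hUu) hU, hW0] with p hp h0
    have h1 := ENNReal.tendsto_atTop_zero_of_tsum_ne_top hp.ne
    have h2 : Tendsto (fun n => ‖U n p - u p‖ₑ ^ 2) atTop (𝓝 0) := by
      have := ENNReal.Tendsto.mul_const (b := (W p)⁻¹) h1 (Or.inr (ENNReal.inv_ne_top.2 h0))
      rw [zero_mul] at this
      refine this.congr fun n => ?_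
      rw [mul_assoc, ENNReal.mul_inv_cancel h0 (hW1 p), mul_one]
    have h3 : Tendsto (fun n => ‖U n p - u p‖ₑ) atTop (𝓝 0) := by
      have := h2.ennrpow_const (1 / 2 : ℝ)
      rw [ENNReal.zero_rpow_of_pos (by norm_num)] at this
      refine this.congr fun n => ?_
      rw [← ENNReal.rpow_natCast, ← ENNReal.rpow_mul]
      norm_num
    have h4 := tendsto_zero_iff_enorm_tendsto_zero.2 h3
    simpa using h4.add_const (u p)
  have hVlim : ∀ᵐ y : ℝ, Tendsto (fun n => ∫⁻ x : ℝ, ‖V n (x, y) - A (x, y)‖ₑ ^ 2 * W (x, y))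
      atTop (𝓝 0) := by
    rw [← lintegral_tsum fun n => (hVA n).aemeasurable, Measure.volume_eq_prod,
      lintegral_prod_symm' _ (Measurable.tsum hVA)] at hV
    filter_upwards [ae_lt_top (Measurable.lintegral_prod_left' (Measurable.tsum hVA)) hV]
      with y hy
    have hm : ∀ n, Measurable fun x => ‖V n (x, y) - A (x, y)‖ₑ ^ 2 * W (x, y) :=
      fun n => (hVA n).comp measurable_prodMk_right
    rw [lintegral_tsum fun n => (hm n).aemeasurable] at hy
    exact ENNReal.tendsto_atTop_zero_of_tsum_ne_top hy.ne
  filter_upwards [ae_all_iff.2 H, hVlim, ae_ae_swap hUlim, hloc, ae_ae_swap hc0, ae_ae_swap hW0]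
    with y h1 h2 h3 h4 h5 h6
  choose w hw hd using h1
  have hgm : Measurable fun x => (c (x, y))⁻¹ * A (x, y) :=
    ((hc.comp measurable_prodMk_right).inv).mul (hA.comp measurable_prodMk_right)
  have hL1 : ∀ R : ℝ, Tendsto (fun n => ∫⁻ x in Set.Icc (-R) R,
      ‖deriv (w n) x - (c (x, y))⁻¹ * A (x, y)‖ₑ) atTop (𝓝 0) := by
    intro R
    have hle : ∀ n, ∫⁻ x in Set.Icc (-R) R, ‖deriv (w n) x - (c (x, y))⁻¹ * A (x, y)‖ₑ ≤
        (∫⁻ x : ℝ, ‖V n (x, y) - A (x, y)‖ₑ ^ 2 * W (x, y)) ^ (1 / 2 : ℝ) *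
        (∫⁻ x in Set.Icc (-R) R, ‖(c (x, y))⁻¹‖ₑ ^ 2 * (W (x, y))⁻¹) ^ (1 / 2 : ℝ) := by
      intro n
      calc ∫⁻ x in Set.Icc (-R) R, ‖deriv (w n) x - (c (x, y))⁻¹ * A (x, y)‖ₑ
          = ∫⁻ x in Set.Icc (-R) R, ‖V n (x, y) - A (x, y)‖ₑ * ‖(c (x, y))⁻¹‖ₑ := by
            refine lintegral_congr_ae (ae_restrict_of_ae ?_)
            filter_upwards [hd n, h5] with x h7 h8
            rw [← enorm_mul, ← h7]
            congr 1
            field_simp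
        _ ≤ _ := lintegral_mul_le_sqrt_mul_sqrt _
            (((hVm n).comp measurable_prodMk_right).sub
              (hA.comp measurable_prodMk_right)).enorm
            (hc.comp measurable_prodMk_right).inv.enorm
            (hW.comp measurable_prodMk_right)
            (ae_restrict_of_ae h6) (Eventually.of_forall fun x => hW1 _)
        _ ≤ _ := by
            refine mul_le_mul' (ENNReal.rpow_le_rpow ?_ (by norm_num)) le_rfl
            exact lintegral_mono' Measure.restrict_le_self le_rfl
    refine tendsto_of_tendsto_of_tendsto_of_le_of_le tendsto_const_nhds ?_ (fun _ => zero_le) hle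
    have h7 := h2.ennrpow_const (1 / 2 : ℝ)
    rw [ENNReal.zero_rpow_of_pos (by norm_num)] at h7
    have h8 := ENNReal.Tendsto.mul_const (b := (∫⁻ x in Set.Icc (-R) R,
      ‖(c (x, y))⁻¹‖ₑ ^ 2 * (W (x, y))⁻¹) ^ (1 / 2 : ℝ)) h7
      (Or.inr (ENNReal.rpow_ne_top_of_nonneg (by norm_num) (h4 R)))
    rwa [zero_mul] at h8
  have hae : ∀ᵐ x : ℝ, Tendsto (fun n => w n x) atTop (𝓝 (u (x, y))) := by
    have : ∀ᵐ x, ∀ n, w n x = U n (x, y) := ae_all_iff.2 fun n => (hw n).2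
    filter_upwards [h3, this] with x h7 h8
    exact h7.congr fun n => (h8 n).symm
  obtain ⟨v, hv, hvd⟩ := exists_isACVersion_of_tendsto (w := w) (h := fun x => u (x, y))
    (g := fun x => (c (x, y))⁻¹ * A (x, y)) (fun n => (hw n).1) hgm hL1 hae
  refine ⟨v, hv, ?_⟩
  filter_upwards [hvd, h5] with x h7 h8
  rw [h7, mul_inv_cancel_left₀ h8]

theorem HasLinePartial.of_tendsto_lintegral {c u A : ℝ × ℝ → ℝ} {W : ℝ × ℝ → ENNReal}
    {U V : ℕ → ℝ × ℝ → ℝ} (hc : Measurable c) (hu : Measurable u) (hA : Measurable A)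
    (hW : Measurable W) (hUm : ∀ n, Measurable (U n)) (hVm : ∀ n, Measurable (V n))
    (hc0 : ∀ᵐ p, c p ≠ 0) (hW0 : ∀ᵐ p, W p ≠ 0) (hW1 : ∀ p, W p ≠ ⊤)
    (hloc : ∀ᵐ y : ℝ, ∀ R : ℝ,
      ∫⁻ x in Set.Icc (-R) R, ‖(c (x, y))⁻¹‖ₑ ^ 2 * (W (x, y))⁻¹ ≠ ⊤)
    (H : ∀ n, HasLinePartial c (U n) (V n))
    (hU : Tendsto (fun n => ∫⁻ p, ‖U n p - u p‖ₑ ^ 2 * W p) atTop (𝓝 0))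
    (hV : Tendsto (fun n => ∫⁻ p, ‖V n p - A p‖ₑ ^ 2 * W p) atTop (𝓝 0)) :
    HasLinePartial c u A := by
  have hpos : ∀ k : ℕ, (0 : ENNReal) < 2⁻¹ ^ k := fun k => ENNReal.pow_pos (by simp) k
  -- A subsequence with errors below `2^{-k}` has summable errors.
  have hsub : ∀ k : ℕ, ∃ n, (∫⁻ p, ‖U n p - u p‖ₑ ^ 2 * W p) < 2⁻¹ ^ k ∧
      (∫⁻ p, ‖V n p - A p‖ₑ ^ 2 * W p) < 2⁻¹ ^ k := fun k =>
    ((hU.eventually (gt_mem_nhds (hpos k))).and (hV.eventually (gt_mem_nhds (hpos k)))).exists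
  choose φ hφ₁ hφ₂ using hsub
  have hgeom : ∑' k : ℕ, (2⁻¹ : ENNReal) ^ k ≠ ⊤ := by
    rw [ENNReal.tsum_geometric]
    simp
  exact of_tsum_ne_top hc hu hA hW (fun k => hUm (φ k)) (fun k => hVm (φ k)) hc0 hW0 hW1 hloc
    (fun k => H (φ k)) (ne_top_of_le_ne_top hgeom (ENNReal.tsum_le_tsum fun k => (hφ₁ k).le))
    (ne_top_of_le_ne_top hgeom (ENNReal.tsum_le_tsum fun k => (hφ₂ k).le))

/-! ### The weighted measure -/

theorem one_sub_abs_pos {ρ : ℝ} (hρ₀ : -1 < ρ) (hρ₁ : ρ < 1) : 0 < 1 - |ρ| := by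
  linarith [abs_lt.2 ⟨hρ₀, hρ₁⟩]

theorem sqrt_one_sub_sq_pos {ρ : ℝ} (hρ₀ : -1 < ρ) (hρ₁ : ρ < 1) : 0 < √(1 - ρ ^ 2) := by
  refine Real.sqrt_pos.2 ?_
  nlinarith

theorem weight_nonneg (β ρ : ℝ) (j : ℕ) (p : ℝ × ℝ) : 0 ≤ weight β ρ j p := by
  unfold weight
  positivity

theorem measurable_weight (β ρ : ℝ) (j : ℕ) : Measurable (weight β ρ j) := by
  unfold weight
  fun_prop

theorem ae_fst_ne_zero : ∀ᵐ p : ℝ × ℝ, p.1 ≠ 0 :=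
  (Measure.quasiMeasurePreserving_fst (μ := (volume : Measure ℝ))
    (ν := (volume : Measure ℝ))).ae (Measure.ae_ne volume 0)

theorem weight_pos {β ρ : ℝ} (hρ₀ : -1 < ρ) (hρ₁ : ρ < 1) (j : ℕ) {p : ℝ × ℝ} (hp : p.1 ≠ 0) :
    0 < weight β ρ j p := by
  have := sqrt_one_sub_sq_pos hρ₀ hρ₁
  have := abs_pos.2 hp
  unfold weight
  positivity

/-- The density is positive off the null line `x = 0`, so both measures have the same null sets. -/
theorem ae_weightedMeasure {β ρ : ℝ} (hρ₀ : -1 < ρ) (hρ₁ : ρ < 1) (j : ℕ) :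
    ae (weightedMeasure β ρ j) = ae (volume : Measure (ℝ × ℝ)) := by
  refine le_antisymm (withDensity_absolutelyContinuous _ _).ae_le ?_
  refine (withDensity_absolutelyContinuous'
    (measurable_weight β ρ j).ennreal_ofReal.aemeasurable ?_).ae_le
  filter_upwards [ae_fst_ne_zero] with p hp
  exact (ENNReal.ofReal_pos.2 (weight_pos hρ₀ hρ₁ j hp)).ne'

theorem lintegral_weightedMeasure (β ρ : ℝ) (j : ℕ) {f : ℝ × ℝ → ENNReal} (hf : Measurable f) :
    ∫⁻ p, f p ∂(weightedMeasure β ρ j) = ∫⁻ p, f p * ENNReal.ofReal (weight β ρ j p) := by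
  rw [weightedMeasure, lintegral_withDensity_eq_lintegral_mul _
    (measurable_weight β ρ j).ennreal_ofReal hf]
  exact lintegral_congr fun p => mul_comm _ _

theorem integral_weightedMeasure (β ρ : ℝ) (j : ℕ) (f : ℝ × ℝ → ℝ) :
    ∫ p, f p ∂(weightedMeasure β ρ j) = ∫ p, weight β ρ j p * f p := by
  rw [weightedMeasure, integral_withDensity_eq_integral_toReal_smul
    (measurable_weight β ρ j).ennreal_ofReal (by simp)]
  simp [ENNReal.toReal_ofReal, weight_nonneg]

theorem integrable_weightedMeasure_iff (β ρ : ℝ) (j : ℕ) (f : ℝ × ℝ → ℝ) :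
    Integrable f (weightedMeasure β ρ j) ↔ Integrable fun p => weight β ρ j p * f p := by
  rw [weightedMeasure, integrable_withDensity_iff_integrable_smul'
    (measurable_weight β ρ j).ennreal_ofReal (by simp)]
  simp [ENNReal.toReal_ofReal, weight_nonneg]

theorem enorm_sq_eq_lintegral {α : Type*} [MeasurableSpace α] {μ : Measure α} (f : Lp ℝ 2 μ) :
    ‖f‖ₑ ^ 2 = ∫⁻ x, ‖f x‖ₑ ^ 2 ∂μ := by
  rw [Lp.enorm_def, eLpNorm_eq_lintegral_rpow_enorm_toReal (by norm_num) (by norm_num),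
    ← ENNReal.rpow_natCast, ← ENNReal.rpow_mul]
  norm_num

theorem tendsto_lintegral_of_tendsto_Lp {β ρ : ℝ} {j : ℕ}
    {u : ℕ → WeightedL2 β ρ j} {v : WeightedL2 β ρ j} (h : Tendsto u atTop (𝓝 v)) :
    Tendsto (fun n => ∫⁻ p, ‖u n p - v p‖ₑ ^ 2 * ENNReal.ofReal (weight β ρ j p))
      atTop (𝓝 0) := by
  have h1 : Tendsto (fun n => ‖u n - v‖ₑ ^ 2) atTop (𝓝 0) := by
    have := tendsto_zero_iff_enorm_tendsto_zero.1 (tendsto_sub_nhds_zero_iff.2 h)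
    have := ENNReal.Tendsto.pow (n := 2) this
    simpa using this
  refine h1.congr fun n => ?_
  rw [enorm_sq_eq_lintegral, ← lintegral_weightedMeasure]
  · refine lintegral_congr_ae ?_
    filter_upwards [Lp.coeFn_sub (u n) v] with p hp
    rw [hp]
    rfl
  · exact (((Lp.stronglyMeasurable _).measurable.sub
      (Lp.stronglyMeasurable _).measurable).enorm).pow_const 2

theorem lintegral_abs_rpow_ne_top {r : ℝ} (hr : -1 < r) (R : ℝ) :
    ∫⁻ x in Set.Icc (-R) R, ENNReal.ofReal (|x| ^ r) ≠ ⊤ := by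
  rcases lt_or_ge R 0 with hR | hR
  · rw [Set.Icc_eq_empty (by linarith)]
    simp
  have h1 : IntervalIntegrable (fun x : ℝ => |x| ^ r) volume 0 R := by
    refine (intervalIntegral.intervalIntegrable_rpow' hr).congr ?_
    intro x hx
    rw [Set.uIoc_of_le hR] at hx
    simp [abs_of_pos hx.1]
  have h2 : IntervalIntegrable (fun x : ℝ => |x| ^ r) volume (-R) 0 := by
    rw [IntervalIntegrable.iff_comp_neg]
    simpa using h1.symm
  have h3 := h2.trans h1
  rw [intervalIntegrable_iff_integrableOn_Icc_of_le (by linarith)] at h3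
  have h4 := h3.lintegral_lt_top
  exact h4.ne

theorem linePartialY_eq_linePartialX_swap (u : ℝ × ℝ → ℝ) :
    linePartialY u = fun p => linePartialX (fun q => u q.swap) p.swap := rfl

theorem aemeasurable_linePartialY {u : ℝ × ℝ → ℝ} (hu : StronglyMeasurable u)
    (h : ∀ᵐ x : ℝ, ∃ w, IsACVersion (fun y => u (x, y)) w) :
    AEMeasurable (linePartialY u) := by
  have hm : StronglyMeasurable fun q : ℝ × ℝ => u q.swap := hu.comp_measurable measurable_swap
  obtain ⟨g, hg, hgu⟩ := aemeasurable_linePartialX hm h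
  rw [linePartialY_eq_linePartialX_swap]
  exact ⟨fun p => g p.swap, hg.comp measurable_swap, ae_swap hgu⟩

/-! ### Weighted gradients of elements of the form domain -/

/-- `A = |x|^β ∂u/∂x` and `B = ∂u/∂y`, with the partial derivatives taken along lines. -/
structure HasGradient (β ρ : ℝ) (j : ℕ) (u A B : WeightedL2 β ρ j) : Prop where
  horizontal : HasLinePartial (fun p => |p.1| ^ β) u A
  vertical : HasLinePartial (fun _ => 1) (u ∘ Prod.swap) (B ∘ Prod.swap)

section

variable {β ρ : ℝ} {j : ℕ}

theorem measurable_coeFn_Lp (u : WeightedL2 β ρ j) : Measurable u :=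
  (Lp.stronglyMeasurable u).measurable

theorem measurable_abs_fst_rpow (β : ℝ) : Measurable fun p : ℝ × ℝ => |p.1| ^ β := by
  fun_prop

theorem abs_rpow_two_mul (β x : ℝ) : |x| ^ (2 * β) = |x| ^ β * |x| ^ β := by
  rw [mul_comm, Real.rpow_mul (abs_nonneg x), Real.rpow_two, sq]

namespace HasGradient

variable {u v A B A' B' : WeightedL2 β ρ j}

theorem mul_linePartialX (H : HasGradient β ρ j u A B) :
    ∀ᵐ p : ℝ × ℝ, |p.1| ^ β * linePartialX u p = A p :=
  H.horizontal.mul_linePartialX (Lp.stronglyMeasurable u) (measurable_abs_fst_rpow β)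
    (measurable_coeFn_Lp A)

theorem linePartialY_eq (H : HasGradient β ρ j u A B) : ∀ᵐ p : ℝ × ℝ, linePartialY u p = B p := by
  have h := ae_swap (H.vertical.mul_linePartialX
    ((Lp.stronglyMeasurable u).comp_measurable measurable_swap) measurable_const
    ((measurable_coeFn_Lp B).comp measurable_swap))
  filter_upwards [h] with p hp
  rw [one_mul] at hp
  exact hp

/-- The factors `|x|^β` are absorbed into `A` and `A'`, which leaves constant coefficients. -/
theorem gam_eq (hρ₀ : -1 < ρ) (hρ₁ : ρ < 1) (H : HasGradient β ρ j u A B)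
    (H' : HasGradient β ρ j v A' B') : Gam β ρ u v =ᵐ[weightedMeasure β ρ j]
      fun p => A p * A' p + ρ * (A p * B' p + B p * A' p) + B p * B' p := by
  rw [EventuallyEq, ae_weightedMeasure hρ₀ hρ₁]
  filter_upwards [H.mul_linePartialX, H'.mul_linePartialX, H.linePartialY_eq, H'.linePartialY_eq]
    with p h1 h2 h3 h4
  rw [Gam, coefForm, abs_rpow_two_mul, ← h1, ← h2, ← h3, ← h4]
  ring

theorem add (hρ₀ : -1 < ρ) (hρ₁ : ρ < 1) (H : HasGradient β ρ j u A B)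
    (H' : HasGradient β ρ j v A' B') : HasGradient β ρ j (u + v) (A + A') (B + B') := by
  have e : ∀ f g : WeightedL2 β ρ j, (f : ℝ × ℝ → ℝ) + (g : ℝ × ℝ → ℝ) =ᵐ[volume]
      (f + g : WeightedL2 β ρ j) := by
    intro f g
    have := Lp.coeFn_add f g
    rw [EventuallyEq, ae_weightedMeasure hρ₀ hρ₁] at this
    exact EventuallyEq.symm this
  exact ⟨(H.horizontal.add H'.horizontal).congr (e _ _) (e _ _),
    (H.vertical.add H'.vertical).congr (ae_swap (e _ _)) (ae_swap (e _ _))⟩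

theorem const_smul (hρ₀ : -1 < ρ) (hρ₁ : ρ < 1) (a : ℝ) (H : HasGradient β ρ j u A B) :
    HasGradient β ρ j (a • u) (a • A) (a • B) := by
  have e : ∀ f : WeightedL2 β ρ j, (fun p => a * f p) =ᵐ[volume] (a • f : WeightedL2 β ρ j) := by
    intro f
    have := Lp.coeFn_smul a f
    rw [EventuallyEq, ae_weightedMeasure hρ₀ hρ₁] at this
    exact EventuallyEq.symm this
  exact ⟨(H.horizontal.const_mul a).congr (e _) (e _),
    (H.vertical.const_mul a).congr (ae_swap (e _)) (ae_swap (e _))⟩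

theorem sub (hρ₀ : -1 < ρ) (hρ₁ : ρ < 1) (H : HasGradient β ρ j u A B)
    (H' : HasGradient β ρ j v A' B') : HasGradient β ρ j (u - v) (A - A') (B - B') := by
  have := H.add hρ₀ hρ₁ (H'.const_smul hρ₀ hρ₁ (-1))
  simpa [sub_eq_add_neg] using this

theorem of_tendsto (hρ₀ : -1 < ρ) (hρ₁ : ρ < 1) (hs : -1 < β * (1 + j) - 2 * β)
    {U V W : ℕ → WeightedL2 β ρ j} (H : ∀ n, HasGradient β ρ j (U n) (V n) (W n))
    (hU : Tendsto U atTop (𝓝 u)) (hV : Tendsto V atTop (𝓝 A)) (hW : Tendsto W atTop (𝓝 B)) :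
    HasGradient β ρ j u A B := by
  have hmW := (measurable_weight β ρ j).ennreal_ofReal
  have hW0 : ∀ᵐ p : ℝ × ℝ, ENNReal.ofReal (weight β ρ j p) ≠ 0 := by
    filter_upwards [ae_fst_ne_zero] with p hp
    exact (ENNReal.ofReal_pos.2 (weight_pos hρ₀ hρ₁ j hp)).ne'
  have hne := Measure.ae_ne (volume : Measure ℝ) 0
  constructor
  · refine HasLinePartial.of_tendsto_lintegral (measurable_abs_fst_rpow β) (measurable_coeFn_Lp u)
      (measurable_coeFn_Lp A) hmW (fun n => measurable_coeFn_Lp (U n))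
      (fun n => measurable_coeFn_Lp (V n)) ?_ hW0 (fun _ => ENNReal.ofReal_ne_top) ?_
      (fun n => (H n).horizontal) (tendsto_lintegral_of_tendsto_Lp hU)
      (tendsto_lintegral_of_tendsto_Lp hV)
    · filter_upwards [ae_fst_ne_zero] with p hp
      exact (Real.rpow_pos_of_pos (abs_pos.2 hp) β).ne'
    · refine Eventually.of_forall fun y R => ?_
      -- The Cauchy–Schwarz weight is a pure power of `|x|`; `hs` says that its exponent exceeds
      -- `-1`.
      have e : ∫⁻ x in Set.Icc (-R) R, ‖(|x| ^ β)⁻¹‖ₑ ^ 2 *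
            (ENNReal.ofReal (weight β ρ j (x, y)))⁻¹
          = ∫⁻ x in Set.Icc (-R) R, ENNReal.ofReal √(1 - ρ ^ 2) *
            ENNReal.ofReal (|x| ^ (β * (1 + j) - 2 * β)) := by
        refine lintegral_congr_ae (ae_restrict_of_ae ?_)
        filter_upwards [hne] with x hx
        have hx' := abs_pos.2 hx
        have h1 := sqrt_one_sub_sq_pos hρ₀ hρ₁
        rw [← ENNReal.ofReal_inv_of_pos (weight_pos hρ₀ hρ₁ j hx), ← ofReal_norm,
          ← ENNReal.ofReal_pow (norm_nonneg _), ← ENNReal.ofReal_mul (by positivity),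
          ← ENNReal.ofReal_mul h1.le]
        congr 1
        rw [Real.norm_of_nonneg (by positivity), weight, Real.rpow_sub hx', abs_rpow_two_mul]
        have := Real.rpow_pos_of_pos hx' β
        field_simp
      simp only [e]
      rw [lintegral_const_mul _ (by fun_prop)]
      exact ENNReal.mul_ne_top ENNReal.ofReal_ne_top (lintegral_abs_rpow_ne_top hs R)
  · have hsw : ∀ f : ℝ × ℝ → ENNReal, ∫⁻ p : ℝ × ℝ, f p.swap = ∫⁻ p, f p := fun f =>
      lintegral_prod_swap (μ := volume) (ν := volume) f
    refine HasLinePartial.of_tendsto_lintegral (U := fun n => U n ∘ Prod.swap)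
      (V := fun n => W n ∘ Prod.swap)
      (W := fun p : ℝ × ℝ => ENNReal.ofReal (weight β ρ j p.swap)) measurable_const
      ((measurable_coeFn_Lp u).comp measurable_swap) ((measurable_coeFn_Lp B).comp measurable_swap)
      (hmW.comp measurable_swap) (fun n => (measurable_coeFn_Lp (U n)).comp measurable_swap)
      (fun n => (measurable_coeFn_Lp (W n)).comp measurable_swap) (by simp) (ae_swap hW0)
      (fun _ => ENNReal.ofReal_ne_top) ?_ (fun n => (H n).vertical) ?_ ?_
    -- The weight is constant along vertical lines, so only the line `x = 0` has to be discarded.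
    · filter_upwards [hne] with y hy R
      have h1 := (ENNReal.ofReal_pos.2 (weight_pos (β := β) hρ₀ hρ₁ j (p := (y, 0)) hy)).ne'
      simp only [Prod.swap_prod_mk, inv_one, enorm_one, one_pow, one_mul]
      have h2 : ∀ x, weight β ρ j (y, x) = weight β ρ j (y, 0) := fun x => rfl
      simp only [h2, lintegral_const]
      exact ENNReal.mul_ne_top (ENNReal.inv_ne_top.2 h1) (by simp)
    · refine (tendsto_lintegral_of_tendsto_Lp hU).congr fun n => ?_
      exact (hsw _).symm
    · refine (tendsto_lintegral_of_tendsto_Lp hW).congr fun n => ?_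
      exact (hsw _).symm

theorem form_eq (hρ₀ : -1 < ρ) (hρ₁ : ρ < 1) (H : HasGradient β ρ j u A B)
    (H' : HasGradient β ρ j v A' B') :
    form β ρ j u v = (1 / 2) * (inner ℝ A A' + ρ * (inner ℝ A B' + inner ℝ B A') + inner ℝ B B') := by
  have e : ∀ f g : WeightedL2 β ρ j,
      inner ℝ f g = ∫ p, f p * g p ∂(weightedMeasure β ρ j) := by
    intro f g
    rw [L2.inner_def]
    refine integral_congr_ae (Eventually.of_forall fun p => ?_)
    simp [mul_comm]
  have i : ∀ f g : WeightedL2 β ρ j,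
      Integrable (fun p => f p * g p) (weightedMeasure β ρ j) := fun f g =>
    (Lp.memLp f).integrable_mul (Lp.memLp g)
  rw [form, integral_congr_ae (H.gam_eq hρ₀ hρ₁ H'), integral_add, integral_add, integral_const_mul,
    integral_add, e, e, e, e]
  · exact i _ _
  · exact i _ _
  · exact i _ _
  · exact ((i _ _).add (i _ _)).const_mul _
  · exact (i _ _).add (((i _ _).add (i _ _)).const_mul _)
  · exact i _ _

theorem integrable_gam (hρ₀ : -1 < ρ) (hρ₁ : ρ < 1) (H : HasGradient β ρ j u A B)
    (H' : HasGradient β ρ j v A' B') : Integrable (Gam β ρ u v) (weightedMeasure β ρ j) := by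
  have i : ∀ f g : WeightedL2 β ρ j,
      Integrable (fun p => f p * g p) (weightedMeasure β ρ j) := fun f g =>
    (Lp.memLp f).integrable_mul (Lp.memLp g)
  refine Integrable.congr ?_ (H.gam_eq hρ₀ hρ₁ H').symm
  exact ((i _ _).add (((i _ _).add (i _ _)).const_mul _)).add (i _ _)

theorem mem_formDomain (hρ₀ : -1 < ρ) (hρ₁ : ρ < 1) (H : HasGradient β ρ j u A B) :
    u ∈ formDomain β ρ j :=
  ⟨H.horizontal.exists_isACVersion, H.vertical.exists_isACVersion, H.integrable_gam hρ₀ hρ₁ H⟩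

end HasGradient

/-- The difference of the two sides is `|ρ| (a ± b)²`, with the sign of `ρ`. -/
theorem quadratic_lower_bound (ρ a b : ℝ) :
    (1 - |ρ|) * (a ^ 2 + b ^ 2) ≤ a * a + ρ * (a * b + b * a) + b * b := by
  rcases abs_cases ρ with ⟨h, h'⟩ | ⟨h, h'⟩ <;> rw [h]
  · nlinarith [mul_nonneg h' (sq_nonneg (a + b))]
  · nlinarith [mul_nonneg (neg_nonneg.2 h'.le) (sq_nonneg (a - b))]

/-- Coercivity bounds each gradient component by the energy density, so integrability of `Γ̃(u, u)`
puts both in `L²`. -/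
theorem exists_hasGradient (hρ₀ : -1 < ρ) (hρ₁ : ρ < 1) {u : WeightedL2 β ρ j}
    (hu : u ∈ formDomain β ρ j) : ∃ A B, HasGradient β ρ j u A B := by
  obtain ⟨h1, h2, h3⟩ := hu
  have hac : weightedMeasure β ρ j ≪ volume := withDensity_absolutelyContinuous _ _
  have hX : AEMeasurable (fun p : ℝ × ℝ => |p.1| ^ β * linePartialX u p) :=
    (measurable_abs_fst_rpow β).aemeasurable.mul
      (aemeasurable_linePartialX (Lp.stronglyMeasurable u) h1)
  have hY : AEMeasurable (linePartialY u) :=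
    aemeasurable_linePartialY (Lp.stronglyMeasurable u) h2
  have hpos := one_sub_abs_pos hρ₀ hρ₁
  have hle : ∀ p, (|p.1| ^ β * linePartialX u p) ^ 2 + (linePartialY u p) ^ 2
      ≤ (1 - |ρ|)⁻¹ * Gam β ρ u u p := by
    intro p
    rw [le_inv_mul_iff₀ hpos]
    refine (quadratic_lower_bound ρ _ _).trans (le_of_eq ?_)
    rw [Gam, coefForm, abs_rpow_two_mul]
    ring
  have hXm : MemLp (fun p : ℝ × ℝ => |p.1| ^ β * linePartialX u p) 2 (weightedMeasure β ρ j) := by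
    have hm := (hX.mono_ac hac).aestronglyMeasurable
    refine (memLp_two_iff_integrable_sq hm).2 ((h3.const_mul (1 - |ρ|)⁻¹).mono' (hm.pow 2) ?_)
    refine Eventually.of_forall fun p => ?_
    rw [Real.norm_of_nonneg (sq_nonneg _)]
    exact (le_add_of_nonneg_right (sq_nonneg _)).trans (hle p)
  have hYm : MemLp (linePartialY u) 2 (weightedMeasure β ρ j) := by
    have hm := (hY.mono_ac hac).aestronglyMeasurable
    refine (memLp_two_iff_integrable_sq hm).2 ((h3.const_mul (1 - |ρ|)⁻¹).mono' (hm.pow 2) ?_)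
    refine Eventually.of_forall fun p => ?_
    rw [Real.norm_of_nonneg (sq_nonneg _)]
    exact (le_add_of_nonneg_left (sq_nonneg _)).trans (hle p)
  have eX := hXm.coeFn_toLp
  have eY := hYm.coeFn_toLp
  rw [EventuallyEq, ae_weightedMeasure hρ₀ hρ₁] at eX eY
  refine ⟨hXm.toLp _, hYm.toLp _, ?_, ?_⟩
  · exact (HasLinePartial.of_exists_isACVersion h1).congr ae_eq_rfl (EventuallyEq.symm eX)
  · refine (HasLinePartial.of_exists_isACVersion (c := fun _ => 1) (u := u ∘ Prod.swap) h2).congr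
      ae_eq_rfl ?_
    filter_upwards [ae_swap eY] with p hp
    rw [one_mul, Function.comp_apply, hp]
    rfl

end

/-! ### The form on its domain -/

section

variable {β ρ : ℝ} {j : ℕ}

namespace HasGradient

variable {u v A B A' B' : WeightedL2 β ρ j}

/-- Together with `form_le`, this makes the energy norm equivalent to the norm of `(u, A, B)`. -/
theorem le_form (hρ₀ : -1 < ρ) (hρ₁ : ρ < 1) (H : HasGradient β ρ j u A B) :
    (1 - |ρ|) / 2 * (‖A‖ ^ 2 + ‖B‖ ^ 2) ≤ form β ρ j u u := by
  rw [H.form_eq hρ₀ hρ₁ H, real_inner_comm A B, real_inner_self_eq_norm_sq,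
    real_inner_self_eq_norm_sq]
  have h1 := abs_real_inner_le_norm A B
  have h2 : |ρ * inner ℝ A B| ≤ |ρ| * (‖A‖ * ‖B‖) := by
    rw [abs_mul]
    gcongr
  have h3 := (abs_le.1 h2).1
  nlinarith [mul_nonneg (abs_nonneg ρ) (sq_nonneg (‖A‖ - ‖B‖))]

theorem form_le (hρ₀ : -1 < ρ) (hρ₁ : ρ < 1) (H : HasGradient β ρ j u A B) :
    form β ρ j u u ≤ ‖A‖ ^ 2 + ‖B‖ ^ 2 := by
  rw [H.form_eq hρ₀ hρ₁ H, real_inner_comm A B, real_inner_self_eq_norm_sq,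
    real_inner_self_eq_norm_sq]
  have h1 := abs_real_inner_le_norm A B
  have h2 : |ρ * inner ℝ A B| ≤ |ρ| * (‖A‖ * ‖B‖) := by
    rw [abs_mul]
    gcongr
  have h3 := (abs_le.1 h2).2
  have h4 : |ρ| * (‖A‖ * ‖B‖) ≤ 1 * (‖A‖ * ‖B‖) := by
    gcongr
    exact (abs_lt.2 ⟨hρ₀, hρ₁⟩).le
  nlinarith [sq_nonneg (‖A‖ - ‖B‖)]

theorem form_self_nonneg (hρ₀ : -1 < ρ) (hρ₁ : ρ < 1) (H : HasGradient β ρ j u A B) :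
    0 ≤ form β ρ j u u := by
  have := one_sub_abs_pos hρ₀ hρ₁
  exact le_trans (by positivity) (H.le_form hρ₀ hρ₁)

theorem norm_le_energyNorm (hρ₀ : -1 < ρ) (hρ₁ : ρ < 1) (H : HasGradient β ρ j u A B) :
    ‖u‖ ≤ energyNorm (form β ρ j) u :=
  Real.le_sqrt_of_sq_le (le_add_of_nonneg_left (H.form_self_nonneg hρ₀ hρ₁))

theorem gradient_le_energyNorm (hρ₀ : -1 < ρ) (hρ₁ : ρ < 1) (H : HasGradient β ρ j u A B) :
    √((1 - |ρ|) / 2) * ‖A‖ ≤ energyNorm (form β ρ j) u ∧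
      √((1 - |ρ|) / 2) * ‖B‖ ≤ energyNorm (form β ρ j) u := by
  have h0 := one_sub_abs_pos hρ₀ hρ₁
  have h1 := H.le_form hρ₀ hρ₁
  have h2 : 0 ≤ (1 - |ρ|) / 2 := by positivity
  constructor <;> refine Real.le_sqrt_of_sq_le ?_ <;> rw [mul_pow, Real.sq_sqrt h2] <;>
    nlinarith [mul_nonneg h2 (sq_nonneg ‖A‖), mul_nonneg h2 (sq_nonneg ‖B‖), sq_nonneg ‖u‖]

theorem energyNorm_le (hρ₀ : -1 < ρ) (hρ₁ : ρ < 1) (H : HasGradient β ρ j u A B) :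
    energyNorm (form β ρ j) u ≤ ‖A‖ + ‖B‖ + ‖u‖ := by
  have h1 := H.form_le hρ₀ hρ₁
  refine Real.sqrt_le_iff.2 ⟨by positivity, ?_⟩
  have ha := norm_nonneg A
  have hb := norm_nonneg B
  have hu := norm_nonneg u
  nlinarith [mul_nonneg ha hb, mul_nonneg ha hu, mul_nonneg hb hu]

end HasGradient

theorem add_mem_formDomain (hρ₀ : -1 < ρ) (hρ₁ : ρ < 1) {u v : WeightedL2 β ρ j}
    (hu : u ∈ formDomain β ρ j) (hv : v ∈ formDomain β ρ j) : u + v ∈ formDomain β ρ j := by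
  obtain ⟨A, B, H⟩ := exists_hasGradient hρ₀ hρ₁ hu
  obtain ⟨A', B', H'⟩ := exists_hasGradient hρ₀ hρ₁ hv
  exact (H.add hρ₀ hρ₁ H').mem_formDomain hρ₀ hρ₁

theorem smul_mem_formDomain (hρ₀ : -1 < ρ) (hρ₁ : ρ < 1) (a : ℝ) {u : WeightedL2 β ρ j}
    (hu : u ∈ formDomain β ρ j) : a • u ∈ formDomain β ρ j := by
  obtain ⟨A, B, H⟩ := exists_hasGradient hρ₀ hρ₁ hu
  exact (H.const_smul hρ₀ hρ₁ a).mem_formDomain hρ₀ hρ₁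

/-- Stated for subsets so as to serve both the full domain and the test functions. -/
theorem isSymmetricForm_of_subset (hρ₀ : -1 < ρ) (hρ₁ : ρ < 1) {D : Set (WeightedL2 β ρ j)}
    (hD : D ⊆ formDomain β ρ j) (h0 : 0 ∈ D) (hadd : ∀ f ∈ D, ∀ g ∈ D, f + g ∈ D)
    (hsmul : ∀ (a : ℝ), ∀ f ∈ D, a • f ∈ D) (hdense : Dense D) :
    IsSymmetricForm (form β ρ j) D where
  zero_mem := h0
  add_mem := hadd
  smul_mem := hsmul
  dense := hdense
  nonneg f hf := by
    obtain ⟨A, B, H⟩ := exists_hasGradient hρ₀ hρ₁ (hD hf)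
    exact H.form_self_nonneg hρ₀ hρ₁
  symm f hf g hg := by
    obtain ⟨A, B, H⟩ := exists_hasGradient hρ₀ hρ₁ (hD hf)
    obtain ⟨A', B', H'⟩ := exists_hasGradient hρ₀ hρ₁ (hD hg)
    rw [H.form_eq hρ₀ hρ₁ H', H'.form_eq hρ₀ hρ₁ H, real_inner_comm A, real_inner_comm A,
      real_inner_comm B, real_inner_comm B]
    ring
  smul_left a f hf g hg := by
    obtain ⟨A, B, H⟩ := exists_hasGradient hρ₀ hρ₁ (hD hf)
    obtain ⟨A', B', H'⟩ := exists_hasGradient hρ₀ hρ₁ (hD hg)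
    rw [H.form_eq hρ₀ hρ₁ H', (H.const_smul hρ₀ hρ₁ a).form_eq hρ₀ hρ₁ H']
    simp only [real_inner_smul_left]
    ring
  add_left f₁ hf₁ f₂ hf₂ g hg := by
    obtain ⟨A₁, B₁, H₁⟩ := exists_hasGradient hρ₀ hρ₁ (hD hf₁)
    obtain ⟨A₂, B₂, H₂⟩ := exists_hasGradient hρ₀ hρ₁ (hD hf₂)
    obtain ⟨A', B', H'⟩ := exists_hasGradient hρ₀ hρ₁ (hD hg)
    rw [H₁.form_eq hρ₀ hρ₁ H', H₂.form_eq hρ₀ hρ₁ H', (H₁.add hρ₀ hρ₁ H₂).form_eq hρ₀ hρ₁ H']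
    simp only [inner_add_left]
    ring

theorem isClosedForm_formDomain (hρ₀ : -1 < ρ) (hρ₁ : ρ < 1) (hs : -1 < β * (1 + j) - 2 * β)
    (hne : (formDomain β ρ j).Nonempty) (hdense : Dense (formDomain β ρ j)) :
    IsClosedForm (form β ρ j) (formDomain β ρ j) where
  toIsSymmetricForm := by
    refine isSymmetricForm_of_subset hρ₀ hρ₁ subset_rfl ?_
      (fun f hf g hg => add_mem_formDomain hρ₀ hρ₁ hf hg)
      (fun a f hf => smul_mem_formDomain hρ₀ hρ₁ a hf) hdense
    obtain ⟨f, hf⟩ := hne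
    simpa using smul_mem_formDomain hρ₀ hρ₁ 0 hf
  complete u hu hcauchy := by
    choose A B H using fun n => exists_hasGradient hρ₀ hρ₁ (hu n)
    have hk : 0 < √((1 - |ρ|) / 2) := Real.sqrt_pos.2 (half_pos (one_sub_abs_pos hρ₀ hρ₁))
    have Hd : ∀ m n, HasGradient β ρ j (u m - u n) (A m - A n) (B m - B n) := fun m n =>
      (H m).sub hρ₀ hρ₁ (H n)
    -- A sequence controlled by the energy norm is Cauchy in `L²`; this is applied to `u`, `A` and
    -- `B`.
    have cauchy : ∀ f : ℕ → WeightedL2 β ρ j, ∀ K > 0,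
        (∀ m n, K * ‖f m - f n‖ ≤ energyNorm (form β ρ j) (u m - u n)) → CauchySeq f := by
      intro f K hK hf
      refine Metric.cauchySeq_iff.2 fun ε hε => ?_
      obtain ⟨N, hN⟩ := hcauchy (K * ε) (by positivity)
      refine ⟨N, fun m hm n hn => ?_⟩
      rw [dist_eq_norm]
      exact lt_of_mul_lt_mul_left ((hf m n).trans_lt (hN m hm n hn)) hK.le
    obtain ⟨u', hu'⟩ := cauchySeq_tendsto_of_complete (cauchy u 1 one_pos fun m n => by
      rw [one_mul]
      exact (Hd m n).norm_le_energyNorm hρ₀ hρ₁)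
    obtain ⟨A', hA'⟩ := cauchySeq_tendsto_of_complete (cauchy A _ hk fun m n =>
      ((Hd m n).gradient_le_energyNorm hρ₀ hρ₁).1)
    obtain ⟨B', hB'⟩ := cauchySeq_tendsto_of_complete (cauchy B _ hk fun m n =>
      ((Hd m n).gradient_le_energyNorm hρ₀ hρ₁).2)
    have H' : HasGradient β ρ j u' A' B' := HasGradient.of_tendsto hρ₀ hρ₁ hs H hu' hA' hB'
    refine ⟨u', H'.mem_formDomain hρ₀ hρ₁, ?_⟩
    refine squeeze_zero (fun n => Real.sqrt_nonneg _)
      (fun n => ((H n).sub hρ₀ hρ₁ H').energyNorm_le hρ₀ hρ₁) ?_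
    have h1 := tendsto_iff_norm_sub_tendsto_zero.1 hu'
    have h2 := tendsto_iff_norm_sub_tendsto_zero.1 hA'
    have h3 := tendsto_iff_norm_sub_tendsto_zero.1 hB'
    simpa using (h2.add h3).add h1

theorem exists_unitContraction_mem_formDomain (hρ₀ : -1 < ρ) (hρ₁ : ρ < 1) {u : WeightedL2 β ρ j}
    (hu : u ∈ formDomain β ρ j) :
    ∃ v ∈ formDomain β ρ j, (v =ᵐ[weightedMeasure β ρ j] fun p => min (max (u p) 0) 1) ∧
      form β ρ j v v ≤ form β ρ j u u := by
  obtain ⟨A, B, H⟩ := exists_hasGradient hρ₀ hρ₁ hu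
  have hS : MeasurableSet ((u : ℝ × ℝ → ℝ) ⁻¹' Set.Ioo 0 1) :=
    measurable_coeFn_Lp u measurableSet_Ioo
  have hv : MemLp (unitContraction ∘ u) 2 (weightedMeasure β ρ j) :=
    lipschitzWith_unitContraction.comp_memLp (by simp [unitContraction]) (Lp.memLp u)
  have hA := (Lp.memLp A).indicator hS
  have hB := (Lp.memLp B).indicator hS
  have ev := hv.coeFn_toLp
  have eA := hA.coeFn_toLp
  have eB := hB.coeFn_toLp
  have ev' := ev
  have eA' := eA
  have eB' := eB
  rw [EventuallyEq, ae_weightedMeasure hρ₀ hρ₁] at ev' eA' eB'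
  have H' : HasGradient β ρ j (hv.toLp _) (hA.toLp _) (hB.toLp _) :=
    ⟨H.horizontal.unitContraction_comp.congr (EventuallyEq.symm ev') (EventuallyEq.symm eA'),
      H.vertical.unitContraction_comp.congr (EventuallyEq.symm (ae_swap ev'))
        (EventuallyEq.symm (ae_swap eB'))⟩
  refine ⟨hv.toLp _, H'.mem_formDomain hρ₀ hρ₁, ev, ?_⟩
  unfold form
  refine mul_le_mul_of_nonneg_left (integral_mono_ae (H'.integrable_gam hρ₀ hρ₁ H')
    (H.integrable_gam hρ₀ hρ₁ H) ?_) (by norm_num)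
  filter_upwards [H.gam_eq hρ₀ hρ₁ H, H'.gam_eq hρ₀ hρ₁ H', eA, eB] with p h1 h2 h3 h4
  rw [h1, h2, h3, h4]
  by_cases hp : p ∈ (u : ℝ × ℝ → ℝ) ⁻¹' Set.Ioo 0 1
  · simp only [Set.indicator_of_mem hp, le_refl]
  -- Where the contraction is flat its energy density is zero, while that of `u` is non-negative.
  · simp only [Set.indicator_of_notMem hp]
    have h5 := one_sub_abs_pos hρ₀ hρ₁
    have h6 : 0 ≤ (1 - |ρ|) * (A p ^ 2 + B p ^ 2) := by positivity
    simpa using h6.trans (quadratic_lower_bound ρ (A p) (B p))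

end

/-! ### Classical partial derivatives -/

section

variable {φ : ℝ × ℝ → ℝ}

theorem hasDerivAt_fst {p : ℝ × ℝ} (hφ : DifferentiableAt ℝ φ p) :
    HasDerivAt (fun s => φ (s, p.2)) (dx φ p) p.1 := by
  have h : HasDerivAt (fun s : ℝ => (s, p.2)) ((1 : ℝ), (0 : ℝ)) p.1 :=
    (hasDerivAt_id p.1).prodMk (hasDerivAt_const p.1 p.2)
  exact (hφ.hasFDerivAt.comp_hasDerivAt p.1 h).differentiableAt.hasDerivAt

theorem hasDerivAt_snd {p : ℝ × ℝ} (hφ : DifferentiableAt ℝ φ p) :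
    HasDerivAt (fun s => φ (p.1, s)) (dy φ p) p.2 := by
  have h : HasDerivAt (fun s : ℝ => (p.1, s)) ((0 : ℝ), (1 : ℝ)) p.2 :=
    (hasDerivAt_const p.2 p.1).prodMk (hasDerivAt_id p.2)
  exact (hφ.hasFDerivAt.comp_hasDerivAt p.2 h).differentiableAt.hasDerivAt

theorem dx_eq_fderiv (hφ : Differentiable ℝ φ) : dx φ = fun p => fderiv ℝ φ p (1, 0) := by
  funext p
  have h : HasDerivAt (fun s : ℝ => (s, p.2)) ((1 : ℝ), (0 : ℝ)) p.1 :=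
    (hasDerivAt_id p.1).prodMk (hasDerivAt_const p.1 p.2)
  exact ((hφ p).hasFDerivAt.comp_hasDerivAt p.1 h).deriv

theorem dy_eq_fderiv (hφ : Differentiable ℝ φ) : dy φ = fun p => fderiv ℝ φ p (0, 1) := by
  funext p
  have h : HasDerivAt (fun s : ℝ => (p.1, s)) ((0 : ℝ), (1 : ℝ)) p.2 :=
    (hasDerivAt_const p.2 p.1).prodMk (hasDerivAt_id p.2)
  exact ((hφ p).hasFDerivAt.comp_hasDerivAt p.2 h).deriv

theorem differentiable_of_contDiff_top (hφ : ContDiff ℝ ((⊤ : ℕ∞) : WithTop ℕ∞) φ) :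
    Differentiable ℝ φ :=
  hφ.differentiable (by simp)

theorem contDiff_dx (hφ : ContDiff ℝ ((⊤ : ℕ∞) : WithTop ℕ∞) φ) :
    ContDiff ℝ ((⊤ : ℕ∞) : WithTop ℕ∞) (dx φ) := by
  rw [dx_eq_fderiv (differentiable_of_contDiff_top hφ)]
  exact (hφ.fderiv_right (m := ((⊤ : ℕ∞) : WithTop ℕ∞)) (by simp)).clm_apply contDiff_const

theorem contDiff_dy (hφ : ContDiff ℝ ((⊤ : ℕ∞) : WithTop ℕ∞) φ) :
    ContDiff ℝ ((⊤ : ℕ∞) : WithTop ℕ∞) (dy φ) := by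
  rw [dy_eq_fderiv (differentiable_of_contDiff_top hφ)]
  exact (hφ.fderiv_right (m := ((⊤ : ℕ∞) : WithTop ℕ∞)) (by simp)).clm_apply contDiff_const

theorem dx_eq_zero {K : Set (ℝ × ℝ)} (hK : IsClosed K) (h : ∀ p ∉ K, φ p = 0) :
    ∀ p ∉ K, dx φ p = 0 := by
  intro p hp
  have h1 : (fun s => φ (s, p.2)) =ᶠ[𝓝 p.1] fun _ => 0 := by
    have hc : Continuous fun s : ℝ => (s, p.2) := by fun_prop
    filter_upwards [hc.continuousAt.preimage_mem_nhds (hK.isOpen_compl.mem_nhds hp)] with s hs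
    exact h _ hs
  rw [dx, h1.deriv_eq, deriv_const]

theorem dy_eq_zero {K : Set (ℝ × ℝ)} (hK : IsClosed K) (h : ∀ p ∉ K, φ p = 0) :
    ∀ p ∉ K, dy φ p = 0 := by
  intro p hp
  have h1 : (fun s => φ (p.1, s)) =ᶠ[𝓝 p.2] fun _ => 0 := by
    have hc : Continuous fun s : ℝ => (p.1, s) := by fun_prop
    filter_upwards [hc.continuousAt.preimage_mem_nhds (hK.isOpen_compl.mem_nhds hp)] with s hs
    exact h _ hs
  rw [dy, h1.deriv_eq, deriv_const]

theorem dx_dy_comm (hφ : ContDiff ℝ ((⊤ : ℕ∞) : WithTop ℕ∞) φ) : dx (dy φ) = dy (dx φ) := by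
  have hd := differentiable_of_contDiff_top hφ
  rw [dx_eq_fderiv (differentiable_of_contDiff_top (contDiff_dy hφ)),
    dy_eq_fderiv (differentiable_of_contDiff_top (contDiff_dx hφ)), dx_eq_fderiv hd,
    dy_eq_fderiv hd]
  funext p
  have h1 : DifferentiableAt ℝ (fderiv ℝ φ) p :=
    (hφ.fderiv_right (m := ((⊤ : ℕ∞) : WithTop ℕ∞)) (by simp)).differentiable (by simp) p
  have h2 := ((contDiff_infty.1 hφ 2).contDiffAt (x := p)).isSymmSndFDerivAt (by simp)
  have h3 : ∀ v : ℝ × ℝ, fderiv ℝ (fun q => fderiv ℝ φ q v) p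
      = (fderiv ℝ (fderiv ℝ φ) p).flip v := by
    intro v
    rw [fderiv_clm_apply h1 (differentiableAt_const v)]
    simp
  rw [h3, h3]
  exact h2 _ _

end

/-! ### Test functions belong to the form domain -/

theorem memLp_of_eq_zero_off_compact {μ : Measure (ℝ × ℝ)} {f : ℝ × ℝ → ℝ} {K : Set (ℝ × ℝ)}
    (hf : Continuous f) (hK : IsCompact K) (hμ : μ K < ⊤) (h0 : ∀ p ∉ K, f p = 0) :
    MemLp f 2 μ := by
  obtain ⟨C, hC⟩ := hK.exists_bound_of_continuousOn hf.continuousOn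
  have e : f = K.indicator f := by
    funext p
    by_cases hp : p ∈ K
    · rw [Set.indicator_of_mem hp]
    · rw [Set.indicator_of_notMem hp, h0 p hp]
  have : Fact (μ K < ⊤) := ⟨hμ⟩
  rw [e, memLp_indicator_iff_restrict hK.measurableSet]
  exact MemLp.of_bound hf.aestronglyMeasurable C
    ((ae_restrict_iff' hK.measurableSet).2 (Eventually.of_forall hC))

section

variable {β ρ : ℝ} {j : ℕ}

/-- Off the axis the weight is continuous, whatever the exponent. -/
theorem weightedMeasure_lt_top_of_isCompact {K : Set (ℝ × ℝ)} (hρ₀ : -1 < ρ) (hρ₁ : ρ < 1)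
    (hK : IsCompact K) (h0 : ∀ p ∈ K, p.1 ≠ 0) : weightedMeasure β ρ j K < ⊤ := by
  have hc : ContinuousOn (weight β ρ j) K := by
    have h1 : ContinuousOn (fun p : ℝ × ℝ => |p.1| ^ (β * (1 + j))) K :=
      (continuous_fst.abs).continuousOn.rpow_const fun p hp => Or.inl (abs_pos.2 (h0 p hp)).ne'
    refine continuousOn_const.div (continuousOn_const.mul h1) fun p hp => ?_
    exact mul_ne_zero (sqrt_one_sub_sq_pos hρ₀ hρ₁).ne'
      (Real.rpow_pos_of_pos (abs_pos.2 (h0 p hp)) _).ne'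
  obtain ⟨C, hC⟩ := hK.exists_bound_of_continuousOn hc
  rw [weightedMeasure, withDensity_apply _ hK.measurableSet]
  refine (setLIntegral_mono measurable_const (g := fun _ => ENNReal.ofReal C) fun p hp =>
    ENNReal.ofReal_le_ofReal ((le_abs_self _).trans (hC p hp))).trans_lt ?_
  rw [setLIntegral_const]
  exact ENNReal.mul_lt_top ENNReal.ofReal_lt_top hK.measure_lt_top

/-- For compact sets meeting the axis, `|x|^{-β(1+j)}` has to be integrable at `0`. -/
theorem isFiniteMeasureOnCompacts_weightedMeasure (hs : β * (1 + j) < 1) :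
    IsFiniteMeasureOnCompacts (weightedMeasure β ρ j) where
  lt_top_of_isCompact {K} hK := by
    obtain ⟨R, hR⟩ := hK.isBounded.subset_closedBall 0
    set I := Set.Icc (-R) R
    have hKI : K ⊆ I ×ˢ I := by
      intro p hp
      have h1 := mem_closedBall_zero_iff.1 (hR hp)
      exact ⟨abs_le.1 ((norm_fst_le p).trans h1), abs_le.1 ((norm_snd_le p).trans h1)⟩
    refine (measure_mono hKI).trans_lt ?_
    rw [weightedMeasure, withDensity_apply _ (measurableSet_Icc.prod measurableSet_Icc),
      Measure.volume_eq_prod, ← Measure.prod_restrict]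
    have e : ∀ p : ℝ × ℝ, ENNReal.ofReal (weight β ρ j p)
        = (ENNReal.ofReal (√(1 - ρ ^ 2))⁻¹ * ENNReal.ofReal (|p.1| ^ (-(β * (1 + j))))) * 1 := by
      intro p
      rw [mul_one, ← ENNReal.ofReal_mul (by positivity), Real.rpow_neg (abs_nonneg _), weight,
        one_div, mul_inv]
    simp only [e]
    rw [lintegral_prod_mul (f := fun x => ENNReal.ofReal (√(1 - ρ ^ 2))⁻¹ *
      ENNReal.ofReal (|x| ^ (-(β * (1 + j))))) (g := fun _ => 1) (by fun_prop) (by fun_prop),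
      lintegral_const_mul _ (by fun_prop)]
    refine ENNReal.mul_lt_top (ENNReal.mul_lt_top ENNReal.ofReal_lt_top ?_) (by simp)
    exact (lintegral_abs_rpow_ne_top (by linarith) R).lt_top

/-- Only finite mass of the support is required, so that functions supported off the axis are
covered for every `β ≥ 0`. -/
theorem exists_hasGradient_of_contDiff (hρ₀ : -1 < ρ) (hρ₁ : ρ < 1) (hβ : 0 ≤ β) {φ : ℝ × ℝ → ℝ}
    (hφ : ContDiff ℝ ((⊤ : ℕ∞) : WithTop ℕ∞) φ) (hc : HasCompactSupport φ)
    (hK : weightedMeasure β ρ j (tsupport φ) < ⊤) :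
    ∃ (h : MemLp φ 2 (weightedMeasure β ρ j))
      (hA : MemLp (fun p => |p.1| ^ β * dx φ p) 2 (weightedMeasure β ρ j))
      (hB : MemLp (dy φ) 2 (weightedMeasure β ρ j)),
      HasGradient β ρ j (h.toLp φ) (hA.toLp _) (hB.toLp _) := by
  have h0 : ∀ p ∉ tsupport φ, φ p = 0 := fun p hp => image_eq_zero_of_notMem_tsupport hp
  have hcl := isClosed_tsupport φ
  have hm : ∀ f : ℝ × ℝ → ℝ, Continuous f → (∀ p ∉ tsupport φ, f p = 0) →
      MemLp f 2 (weightedMeasure β ρ j) := fun f hf h =>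
    memLp_of_eq_zero_off_compact hf hc.isCompact hK h
  have hX : Continuous fun p : ℝ × ℝ => |p.1| ^ β * dx φ p :=
    (continuous_fst.abs.rpow_const fun _ => Or.inr hβ).mul (contDiff_dx hφ).continuous
  refine ⟨hm _ hφ.continuous h0, hm _ hX fun p hp => by rw [dx_eq_zero hcl h0 p hp, mul_zero],
    hm _ (contDiff_dy hφ).continuous (dy_eq_zero hcl h0), ?_, ?_⟩
  · refine HasLinePartial.congr (u := φ) (A := fun p => |p.1| ^ β * dx φ p)
      (Eventually.of_forall fun y => ⟨fun x => φ (x, y), ?_, Eventually.of_forall fun x => rfl⟩)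
      ?_ ?_
    · refine isACVersion_of_contDiff ?_
      have : ContDiff ℝ ((⊤ : ℕ∞) : WithTop ℕ∞) fun x : ℝ => φ (x, y) := by fun_prop
      exact this.of_le (by simp)
    all_goals
      rw [EventuallyEq, ← ae_weightedMeasure hρ₀ hρ₁ (β := β) j]
      exact EventuallyEq.symm (MemLp.coeFn_toLp _)
  · refine HasLinePartial.congr (u := φ ∘ Prod.swap) (A := dy φ ∘ Prod.swap)
      (Eventually.of_forall fun y => ⟨fun x => φ (y, x), ?_, Eventually.of_forall fun x => ?_⟩)
      ?_ ?_
    · refine isACVersion_of_contDiff ?_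
      have : ContDiff ℝ ((⊤ : ℕ∞) : WithTop ℕ∞) fun x : ℝ => φ (y, x) := by fun_prop
      exact this.of_le (by simp)
    · rw [one_mul]
      rfl
    all_goals
      refine ae_swap (P := fun p => _ = _) ?_
      rw [← ae_weightedMeasure hρ₀ hρ₁ (β := β) j]
      exact EventuallyEq.symm (MemLp.coeFn_toLp _)

theorem testDomain_subset_formDomain (hρ₀ : -1 < ρ) (hρ₁ : ρ < 1) (hβ : 0 ≤ β)
    (hs : β * (1 + j) < 1) : testDomain β ρ j ⊆ formDomain β ρ j := by
  rintro u ⟨φ, hφ, hu⟩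
  have := isFiniteMeasureOnCompacts_weightedMeasure (ρ := ρ) hs
  obtain ⟨h, hA, hB, H⟩ := exists_hasGradient_of_contDiff hρ₀ hρ₁ hβ hφ.smooth hφ.compact
    (j := j) hφ.compact.isCompact.measure_lt_top
  have : u = h.toLp φ := Lp.ext (hu.trans h.coeFn_toLp.symm)
  rw [this]
  exact H.mem_formDomain hρ₀ hρ₁

theorem dense_testDomain (hs : β * (1 + j) < 1) : Dense (testDomain β ρ j) := by
  have := isFiniteMeasureOnCompacts_weightedMeasure (ρ := ρ) hs
  refine (Lp.dense_hasCompactSupport_contDiff (μ := weightedMeasure β ρ j) (F := ℝ)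
    (p := 2) (by norm_num)).mono ?_
  rintro u ⟨g, hg, hc, hd⟩
  exact ⟨g, ⟨hd, hc, Set.subset_univ _⟩, hg⟩

theorem isSymmetricForm_testDomain (hρ₀ : -1 < ρ) (hρ₁ : ρ < 1) (hβ : 0 ≤ β)
    (hs : β * (1 + j) < 1) : IsSymmetricForm (form β ρ j) (testDomain β ρ j) := by
  refine isSymmetricForm_of_subset hρ₀ hρ₁ (testDomain_subset_formDomain hρ₀ hρ₁ hβ hs) ?_ ?_ ?_
    (dense_testDomain hs)
  · exact ⟨0, ⟨contDiff_const, HasCompactSupport.zero, Set.subset_univ _⟩, Lp.coeFn_zero _ _ _⟩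
  · rintro f ⟨φ, hφ, hf⟩ g ⟨ψ, hψ, hg⟩
    exact ⟨φ + ψ, ⟨hφ.smooth.add hψ.smooth, hφ.compact.add hψ.compact, Set.subset_univ _⟩,
      (Lp.coeFn_add f g).trans (hf.add hg)⟩
  · rintro a f ⟨φ, hφ, hf⟩
    exact ⟨a • φ, ⟨hφ.smooth.const_smul a, hφ.compact.smul_left (f := fun _ => a),
      Set.subset_univ _⟩, (Lp.coeFn_smul a f).trans (hf.const_smul a)⟩

theorem isDirichletForm_formDomain (hρ₀ : -1 < ρ) (hρ₁ : ρ < 1) (hβ : 0 ≤ β)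
    (hs : β * (1 + j) < 1) (hs' : -1 < β * (1 + j) - 2 * β) :
    IsDirichletForm (form β ρ j) (formDomain β ρ j) where
  toIsClosedForm := by
    have hsub := testDomain_subset_formDomain (j := j) hρ₀ hρ₁ hβ hs
    have hd := (dense_testDomain (ρ := ρ) hs).mono hsub
    exact isClosedForm_formDomain hρ₀ hρ₁ hs' hd.nonempty hd
  markov _ hu := exists_unitContraction_mem_formDomain hρ₀ hρ₁ hu

theorem form_eq_integral_coefForm (hρ₀ : -1 < ρ) (hρ₁ : ρ < 1) (hβ : 0 ≤ β)
    (hs : β * (1 + j) < 1) {f₁ f₂ : ℝ × ℝ → ℝ} (hf₁ : IsTestFunction Set.univ f₁)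
    (hf₂ : IsTestFunction Set.univ f₂) :
    ∃ (h₁ : MemLp f₁ 2 (weightedMeasure β ρ j)) (h₂ : MemLp f₂ 2 (weightedMeasure β ρ j)),
      Integrable (fun p => coefForm β ρ p (dx f₁ p) (dy f₁ p) (dx f₂ p) (dy f₂ p))
        (weightedMeasure β ρ j) ∧
      form β ρ j (h₁.toLp f₁) (h₂.toLp f₂) =
        (1 / 2) * ∫ p, coefForm β ρ p (dx f₁ p) (dy f₁ p) (dx f₂ p) (dy f₂ p)
          ∂(weightedMeasure β ρ j) := by
  have := isFiniteMeasureOnCompacts_weightedMeasure (ρ := ρ) hs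
  obtain ⟨h₁, hA₁, hB₁, H₁⟩ := exists_hasGradient_of_contDiff hρ₀ hρ₁ hβ hf₁.smooth hf₁.compact
    (j := j) hf₁.compact.isCompact.measure_lt_top
  obtain ⟨h₂, hA₂, hB₂, H₂⟩ := exists_hasGradient_of_contDiff hρ₀ hρ₁ hβ hf₂.smooth hf₂.compact
    (j := j) hf₂.compact.isCompact.measure_lt_top
  have e : Gam β ρ (h₁.toLp f₁) (h₂.toLp f₂) =ᵐ[weightedMeasure β ρ j]
      fun p => coefForm β ρ p (dx f₁ p) (dy f₁ p) (dx f₂ p) (dy f₂ p) := by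
    filter_upwards [H₁.gam_eq hρ₀ hρ₁ H₂, hA₁.coeFn_toLp, hB₁.coeFn_toLp, hA₂.coeFn_toLp,
      hB₂.coeFn_toLp] with p h3 h4 h5 h6 h7
    rw [h3, h4, h5, h6, h7, coefForm, abs_rpow_two_mul]
    ring
  refine ⟨h₁, h₂, (H₁.integrable_gam hρ₀ hρ₁ H₂).congr e, ?_⟩
  rw [form, integral_congr_ae e]

end

/-! ### Integration by parts -/

theorem IsACVersion.integral_mul_deriv {h w ψ D : ℝ → ℝ} {R : ℝ} (H : IsACVersion h w)
    (hψ : ∀ x, HasDerivAt ψ (D x) x) (hD : Continuous D)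
    (h0 : ∀ x, R ≤ |x| → ψ x = 0 ∧ D x = 0) :
    ∫ x, ψ x * deriv w x = -∫ x, D x * h x := by
  have hψ1 : ContDiff ℝ 1 ψ := by
    rw [contDiff_one_iff_deriv]
    refine ⟨fun x => (hψ x).differentiableAt, ?_⟩
    rwa [show deriv ψ = D from funext fun x => (hψ x).deriv]
  -- `R` may be negative; `S ≥ 0` keeps the interval oriented.
  set S := max R 0 with hS
  have hS0 : -S ≤ S := neg_le_self (le_max_right _ _)
  have hSR : ∀ x, x ∉ Set.Ioc (-S) S → R ≤ |x| := by
    intro x hx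
    by_contra hlt
    have := abs_lt.1 ((not_le.1 hlt).trans_le (le_max_left R 0))
    exact hx ⟨this.1, this.2.le⟩
  have e1 : ∫ x, ψ x * deriv w x = ∫ x in (-S)..S, ψ x * deriv w x := by
    rw [intervalIntegral.integral_of_le hS0]
    refine (setIntegral_eq_integral_of_forall_compl_eq_zero fun x hx => ?_).symm
    rw [(h0 x (hSR x hx)).1, zero_mul]
  have e2 : ∫ x, D x * h x = ∫ x in (-S)..S, deriv ψ x * w x := by
    rw [intervalIntegral.integral_of_le hS0]
    rw [← setIntegral_eq_integral_of_forall_compl_eq_zero (s := Set.Ioc (-S) S) fun x hx => ?_]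
    · refine integral_congr_ae (ae_restrict_of_ae ?_)
      filter_upwards [H.2] with x hx
      rw [hx, (hψ x).deriv]
    · rw [(h0 x (hSR x hx)).2, zero_mul]
  have hb : ψ S = 0 ∧ ψ (-S) = 0 := by
    constructor <;> refine (h0 _ ?_).1
    · exact (le_max_left _ _).trans (le_abs_self _)
    · rw [abs_neg]
      exact (le_max_left _ _).trans (le_abs_self _)
  rw [e1, e2, AbsolutelyContinuousOnInterval.integral_mul_deriv_eq_deriv_mul
    hψ1.contDiffOn.absolutelyContinuousOnInterval (H.1 _ _), hb.1, hb.2]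
  ring

/-- Fubini reduces to integration by parts on each line. Differentiability is asked only of the
product `θ c`, since `c = |x|^β` may fail to be smooth at `0`. -/
theorem HasLinePartial.integral_mul {c u A θ D : ℝ × ℝ → ℝ} {R : ℝ} (H : HasLinePartial c u A)
    (hθ : ∀ y x, HasDerivAt (fun s => θ (s, y) * c (s, y)) (D (x, y)) x) (hD : Continuous D)
    (h0 : ∀ p, R ≤ |p.1| → θ p = 0 ∧ D p = 0) (hA : Integrable fun p => θ p * A p)
    (hu : Integrable fun p => D p * u p) :
    ∫ p, θ p * A p = -∫ p, D p * u p := by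
  rw [Measure.volume_eq_prod] at hA hu ⊢
  rw [integral_prod_symm _ hA, integral_prod_symm _ hu, ← integral_neg]
  refine integral_congr_ae ?_
  filter_upwards [H] with y ⟨w, hw, hd⟩
  rw [← hw.integral_mul_deriv (hθ y) (by fun_prop)
    (fun x hx => ⟨by rw [(h0 (x, y) hx).1, zero_mul], (h0 (x, y) hx).2⟩)]
  refine integral_congr_ae ?_
  filter_upwards [hd] with x hx
  rw [← hx, mul_assoc]

section

variable {β ρ : ℝ} {j : ℕ}

theorem inner_eq_integral (f g : WeightedL2 β ρ j) :
    inner ℝ f g = ∫ p, weight β ρ j p * (f p * g p) := by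
  rw [← integral_weightedMeasure, L2.inner_def]
  refine integral_congr_ae (Eventually.of_forall fun p => ?_)
  simp [mul_comm]

theorem inner_toLp_eq_integral (hρ₀ : -1 < ρ) (hρ₁ : ρ < 1) {f : ℝ × ℝ → ℝ}
    (hf : MemLp f 2 (weightedMeasure β ρ j)) (g : WeightedL2 β ρ j) :
    inner ℝ (hf.toLp f) g = ∫ p, weight β ρ j p * f p * g p := by
  rw [inner_eq_integral]
  have := hf.coeFn_toLp
  rw [EventuallyEq, ae_weightedMeasure hρ₀ hρ₁] at this
  refine integral_congr_ae ?_
  filter_upwards [this] with p hp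
  rw [hp, mul_assoc]

theorem integrable_weight_mul_mul {f : ℝ × ℝ → ℝ} (hf : MemLp f 2 (weightedMeasure β ρ j))
    (g : WeightedL2 β ρ j) : Integrable fun p => weight β ρ j p * f p * g p := by
  have h := hf.integrable_mul (Lp.memLp g)
  rw [integrable_weightedMeasure_iff] at h
  refine h.congr (Eventually.of_forall fun p => ?_)
  simp [mul_assoc]

/-- Here `L` is the weighted divergence `m⁻¹ ∂ₓ(m P |x|^β)` of the flux `P`, with `m` the weight. -/
theorem HasGradient.inner_horizontal (hρ₀ : -1 < ρ) (hρ₁ : ρ < 1) {v A B : WeightedL2 β ρ j}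
    (H : HasGradient β ρ j v A B) {P L : ℝ × ℝ → ℝ} {R : ℝ}
    (hP : MemLp P 2 (weightedMeasure β ρ j)) (hL : MemLp L 2 (weightedMeasure β ρ j))
    (hd : ∀ y x, HasDerivAt (fun s => weight β ρ j (s, y) * P (s, y) * |s| ^ β)
      (weight β ρ j (x, y) * L (x, y)) x)
    (hc : Continuous fun p => weight β ρ j p * L p) (h0 : ∀ p, R ≤ |p.1| → P p = 0 ∧ L p = 0) :
    inner ℝ (hP.toLp P) A = -inner ℝ (hL.toLp L) v := by
  rw [inner_toLp_eq_integral hρ₀ hρ₁, inner_toLp_eq_integral hρ₀ hρ₁]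
  exact H.horizontal.integral_mul (θ := fun p => weight β ρ j p * P p)
    (D := fun p => weight β ρ j p * L p) (R := R) hd hc
    (fun p hp => by simp [h0 p hp]) (integrable_weight_mul_mul hP A) (integrable_weight_mul_mul hL v)

theorem HasGradient.inner_vertical (hρ₀ : -1 < ρ) (hρ₁ : ρ < 1) {v A B : WeightedL2 β ρ j}
    (H : HasGradient β ρ j v A B) {P L : ℝ × ℝ → ℝ} {R : ℝ}
    (hP : MemLp P 2 (weightedMeasure β ρ j)) (hL : MemLp L 2 (weightedMeasure β ρ j))
    (hd : ∀ x y, HasDerivAt (fun s => weight β ρ j (x, s) * P (x, s))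
      (weight β ρ j (x, y) * L (x, y)) y)
    (hc : Continuous fun p => weight β ρ j p * L p) (h0 : ∀ p, R ≤ |p.2| → P p = 0 ∧ L p = 0) :
    inner ℝ (hP.toLp P) B = -inner ℝ (hL.toLp L) v := by
  have hsw : ∀ f : ℝ × ℝ → ℝ, ∫ p, f p = ∫ p : ℝ × ℝ, f p.swap := fun f =>
    (integral_prod_swap (μ := volume) (ν := volume) f).symm
  have isw : ∀ f : ℝ × ℝ → ℝ, Integrable f → Integrable fun p : ℝ × ℝ => f p.swap := fun f hf =>
    Integrable.swap (μ := volume) (ν := volume) hf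
  rw [inner_toLp_eq_integral hρ₀ hρ₁, inner_toLp_eq_integral hρ₀ hρ₁, hsw,
    hsw fun p => weight β ρ j p * L p * v p]
  refine H.vertical.integral_mul (θ := fun p => weight β ρ j p.swap * P p.swap)
    (D := fun p => weight β ρ j p.swap * L p.swap) (R := R) (fun x y => ?_)
    (hc.comp continuous_swap) (fun p hp => ?_) (isw _ (integrable_weight_mul_mul hP B))
    (isw _ (integrable_weight_mul_mul hL v))
  · simp only [mul_one]
    exact hd x y
  · simp [h0 p.swap hp]

/-! ### The generator on test functions -/

/-- Smooth functions supported off the axis lie in the domain for every `β ≥ 0` and determine `w`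
off a null set. This gives uniqueness of the generator's value also where the weight is not locally
integrable. -/
theorem eq_zero_of_inner_formDomain_eq_zero (hρ₀ : -1 < ρ) (hρ₁ : ρ < 1) (hβ : 0 ≤ β)
    {w : WeightedL2 β ρ j} (h : ∀ v ∈ formDomain β ρ j, inner ℝ w v = 0) : w = 0 := by
  have hU : IsOpen {p : ℝ × ℝ | p.1 ≠ 0} := isOpen_ne_fun continuous_fst continuous_const
  have hloc : LocallyIntegrableOn w {p : ℝ × ℝ | p.1 ≠ 0} (weightedMeasure β ρ j) := by
    refine (locallyIntegrableOn_iff hU.isLocallyClosed).2 fun K hKU hK => ?_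
    have : Fact (weightedMeasure β ρ j K < ⊤) :=
      ⟨weightedMeasure_lt_top_of_isCompact hρ₀ hρ₁ hK hKU⟩
    exact ((Lp.memLp w).restrict K).integrable one_le_two
  have h0 := hU.ae_eq_zero_of_integral_contDiff_smul_eq_zero hloc fun g hg hgc hgs => by
    obtain ⟨h1, hA, hB, H⟩ := exists_hasGradient_of_contDiff (j := j) hρ₀ hρ₁ hβ hg hgc
      (weightedMeasure_lt_top_of_isCompact hρ₀ hρ₁ hgc.isCompact hgs)
    have h2 := h _ (H.mem_formDomain hρ₀ hρ₁)
    rw [L2.inner_def] at h2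
    rw [← h2]
    refine integral_congr_ae ?_
    filter_upwards [h1.coeFn_toLp] with p hp
    simp [hp]
  refine Lp.ext ?_
  have h3 : ∀ᵐ p ∂(weightedMeasure β ρ j), p.1 ≠ 0 := by
    rw [ae_weightedMeasure hρ₀ hρ₁]
    exact ae_fst_ne_zero
  filter_upwards [h0, h3, Lp.coeFn_zero ℝ 2 (weightedMeasure β ρ j)] with p h4 h5 h6
  rw [h4 h5, h6]
  rfl

theorem generator_eq (hρ₀ : -1 < ρ) (hρ₁ : ρ < 1) (hβ : 0 ≤ β) {u w : WeightedL2 β ρ j}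
    (hu : u ∈ formDomain β ρ j) (h : ∀ v ∈ formDomain β ρ j, form β ρ j u v = -inner ℝ w v) :
    u ∈ generatorDomain (form β ρ j) (formDomain β ρ j) ∧
      generator (form β ρ j) (formDomain β ρ j) u = w := by
  have hu' : u ∈ generatorDomain (form β ρ j) (formDomain β ρ j) := ⟨hu, w, h⟩
  refine ⟨hu', ?_⟩
  rw [generator, dif_pos hu', ← sub_eq_zero]
  refine eq_zero_of_inner_formDomain_eq_zero hρ₀ hρ₁ hβ fun v hv => ?_
  rw [inner_sub_left]
  have h1 := hu'.2.choose_spec v hv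
  rw [h v hv] at h1
  linarith

/-! ### Divergence form of the operators on the quadrant. -/

theorem isOpen_quadrant : IsOpen quadrant :=
  (isOpen_lt continuous_const continuous_fst).inter (isOpen_lt continuous_const continuous_snd)

theorem continuous_of_continuousOn_quadrant {K : Set (ℝ × ℝ)} (hK : IsClosed K)
    (hKq : K ⊆ quadrant) {f : ℝ × ℝ → ℝ} (hf : ContinuousOn f quadrant)
    (h0 : ∀ p ∉ K, f p = 0) : Continuous f := by
  refine hf.continuous_of_tsupport_subset isOpen_quadrant ?_
  refine (closure_minimal (fun p hp => ?_) hK).trans hKq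
  by_contra hpK
  exact hp (h0 p hpK)

theorem continuousOn_fst_rpow (r : ℝ) : ContinuousOn (fun p : ℝ × ℝ => p.1 ^ r) quadrant :=
  continuous_fst.continuousOn.rpow_const fun _ hp => Or.inl hp.1.ne'

theorem continuousOn_weight_quadrant (hρ₀ : -1 < ρ) (hρ₁ : ρ < 1) :
    ContinuousOn (weight β ρ j) quadrant := by
  have h1 : ContinuousOn (fun p : ℝ × ℝ => |p.1| ^ (β * (1 + j))) quadrant :=
    (continuous_fst.abs).continuousOn.rpow_const fun p hp => Or.inl (abs_pos.2 hp.1.ne').ne'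
  refine continuousOn_const.div (continuousOn_const.mul h1) fun p hp => ?_
  exact mul_ne_zero (sqrt_one_sub_sq_pos hρ₀ hρ₁).ne'
    (Real.rpow_pos_of_pos (abs_pos.2 hp.1.ne') _).ne'

/-- The horizontal part of twice the generator. -/
def horizontalOp (β ρ : ℝ) (j : ℕ) (f : ℝ × ℝ → ℝ) (p : ℝ × ℝ) : ℝ :=
  p.1 ^ (2 * β) * dx (dx f) p + (2 * β - β * (1 + j)) * p.1 ^ (2 * β - 1) * dx f p +
    ρ * (p.1 ^ β * dx (dy f) p + (β - β * (1 + j)) * p.1 ^ (β - 1) * dy f p)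

/-- The vertical part of twice the generator. -/
def verticalOp (β ρ : ℝ) (f : ℝ × ℝ → ℝ) (p : ℝ × ℝ) : ℝ :=
  ρ * p.1 ^ β * dy (dx f) p + dy (dy f) p

theorem hasDerivAt_horizontal_flux (f : ℝ × ℝ → ℝ)
    (hf : ContDiff ℝ ((⊤ : ℕ∞) : WithTop ℕ∞) f) {x y : ℝ} (hx : 0 < x) :
    HasDerivAt (fun s => weight β ρ j (s, y) * (|s| ^ β * dx f (s, y) + ρ * dy f (s, y)) * |s| ^ β)
      (weight β ρ j (x, y) * horizontalOp β ρ j f (x, y)) x := by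
  set σ := β * (1 + j) with hσ
  set r := √(1 - ρ ^ 2) with hr
  -- Near `x > 0` the absolute values disappear and the powers merge with the weight.
  have e : (fun s => weight β ρ j (s, y) * (|s| ^ β * dx f (s, y) + ρ * dy f (s, y)) * |s| ^ β)
      =ᶠ[𝓝 x] fun s => r⁻¹ * (s ^ (2 * β - σ) * dx f (s, y) + ρ * (s ^ (β - σ) * dy f (s, y))) := by
    filter_upwards [lt_mem_nhds hx] with s hs
    rw [weight, abs_of_pos hs, Real.rpow_sub hs, Real.rpow_sub hs, two_mul, Real.rpow_add hs]
    simp only [mul_inv, div_eq_mul_inv]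
    ring
  have h1 := hasDerivAt_fst (p := (x, y)) (differentiable_of_contDiff_top (contDiff_dx hf) (x, y))
  have h2 := hasDerivAt_fst (p := (x, y)) (differentiable_of_contDiff_top (contDiff_dy hf) (x, y))
  have h3 := Real.hasDerivAt_rpow_const (x := x) (p := 2 * β - σ) (Or.inl hx.ne')
  have h4 := Real.hasDerivAt_rpow_const (x := x) (p := β - σ) (Or.inl hx.ne')
  refine HasDerivAt.congr_of_eventuallyEq ?_ e
  refine (((h3.mul h1).add ((h4.mul h2).const_mul ρ)).const_mul r⁻¹).congr_deriv ?_
  rw [weight, horizontalOp, abs_of_pos hx]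
  rw [← hσ, ← hr, show 2 * β - σ - 1 = 2 * β - 1 - σ by ring, show β - σ - 1 = β - 1 - σ by ring,
    Real.rpow_sub hx _ σ, Real.rpow_sub hx _ σ, Real.rpow_sub hx _ σ, Real.rpow_sub hx _ σ]
  simp only [mul_inv, div_eq_mul_inv]
  ring

theorem hasDerivAt_vertical_flux (f : ℝ × ℝ → ℝ)
    (hf : ContDiff ℝ ((⊤ : ℕ∞) : WithTop ℕ∞) f) {x y : ℝ} (hx : 0 < x) :
    HasDerivAt (fun s => weight β ρ j (x, s) * (ρ * (|x| ^ β * dx f (x, s)) + dy f (x, s)))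
      (weight β ρ j (x, y) * verticalOp β ρ f (x, y)) y := by
  have h1 := hasDerivAt_snd (p := (x, y)) (differentiable_of_contDiff_top (contDiff_dx hf) (x, y))
  have h2 := hasDerivAt_snd (p := (x, y)) (differentiable_of_contDiff_top (contDiff_dy hf) (x, y))
  have hw : ∀ s, weight β ρ j (x, s) = weight β ρ j (x, y) := fun s => rfl
  simp only [hw]
  refine ((((h1.const_mul (|x| ^ β)).const_mul ρ).add h2).const_mul _).congr_deriv ?_
  rw [verticalOp, abs_of_pos hx]
  ring

/-- The identity `Ẽ(f, v) = -(L f, v)` must hold for every `v` in the domain, so the regularity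
needed for integration by parts is that of `v` along lines. -/
theorem generatorMatches_of_eq (hρ₀ : -1 < ρ) (hρ₁ : ρ < 1) (hβ : 0 ≤ β)
    {L : (ℝ × ℝ → ℝ) → ℝ × ℝ → ℝ}
    (hL : ∀ f, IsTestFunction quadrant f →
      L f = fun p => (1 / 2) * (horizontalOp β ρ j f p + verticalOp β ρ f p)) :
    GeneratorMatches β ρ j L := by
  have key : ∀ f, IsTestFunction quadrant f →
      ∃ (h : MemLp f 2 (weightedMeasure β ρ j)) (h' : MemLp (L f) 2 (weightedMeasure β ρ j)),
        h.toLp f ∈ formDomain β ρ j ∧ ∀ v ∈ formDomain β ρ j,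
          form β ρ j (h.toLp f) v = -inner ℝ (h'.toLp (L f)) v := by
    intro f hf
    have hKc := hf.compact.isCompact
    have hcl := isClosed_tsupport f
    have hμ : weightedMeasure β ρ j (tsupport f) < ⊤ :=
      weightedMeasure_lt_top_of_isCompact hρ₀ hρ₁ hKc fun p hp => (hf.support hp).1.ne'
    have h0 : ∀ p ∉ tsupport f, f p = 0 := fun p hp => image_eq_zero_of_notMem_tsupport hp
    have hx0 := dx_eq_zero hcl h0
    have hy0 := dy_eq_zero hcl h0
    have hxx0 := dx_eq_zero hcl hx0
    have hxy0 := dx_eq_zero hcl hy0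
    have hyx0 := dy_eq_zero hcl hx0
    have hyy0 := dy_eq_zero hcl hy0
    have cx := (contDiff_dx hf.smooth).continuous
    have cy := (contDiff_dy hf.smooth).continuous
    have cxx := (contDiff_dx (contDiff_dx hf.smooth)).continuous
    have cxy := (contDiff_dx (contDiff_dy hf.smooth)).continuous
    have cyx := (contDiff_dy (contDiff_dx hf.smooth)).continuous
    have cyy := (contDiff_dy (contDiff_dy hf.smooth)).continuous
    have hH0 : ∀ p ∉ tsupport f, horizontalOp β ρ j f p = 0 := fun p hp => by
      simp [horizontalOp, hx0 p hp, hy0 p hp, hxx0 p hp, hxy0 p hp]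
    have hV0 : ∀ p ∉ tsupport f, verticalOp β ρ f p = 0 := fun p hp => by
      simp [verticalOp, hyx0 p hp, hyy0 p hp]
    have cH : ContinuousOn (horizontalOp β ρ j f) quadrant := by
      refine ContinuousOn.add (ContinuousOn.add ?_ ?_) (continuousOn_const.mul
        (ContinuousOn.add ?_ ?_))
      · exact (continuousOn_fst_rpow _).mul cxx.continuousOn
      · exact (continuousOn_const.mul (continuousOn_fst_rpow _)).mul cx.continuousOn
      · exact (continuousOn_fst_rpow _).mul cxy.continuousOn
      · exact (continuousOn_const.mul (continuousOn_fst_rpow _)).mul cy.continuousOn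
    have cV : ContinuousOn (verticalOp β ρ f) quadrant :=
      ((continuousOn_const.mul (continuousOn_fst_rpow _)).mul cyx.continuousOn).add
        cyy.continuousOn
    have cW := continuousOn_weight_quadrant (β := β) (j := j) hρ₀ hρ₁
    have cont : ∀ g : ℝ × ℝ → ℝ, ContinuousOn g quadrant → (∀ p ∉ tsupport f, g p = 0) →
        Continuous g := fun g hg hg0 => continuous_of_continuousOn_quadrant hcl hf.support hg hg0
    have mem : ∀ g : ℝ × ℝ → ℝ, ContinuousOn g quadrant → (∀ p ∉ tsupport f, g p = 0) →
        MemLp g 2 (weightedMeasure β ρ j) := fun g hg hg0 =>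
      memLp_of_eq_zero_off_compact (cont g hg hg0) hKc hμ hg0
    have cabs : ContinuousOn (fun p : ℝ × ℝ => |p.1| ^ β) quadrant :=
      (continuous_fst.abs.rpow_const fun _ => Or.inr hβ).continuousOn
    have hH := mem _ cH hH0
    have hV := mem _ cV hV0
    have hP := mem (fun p => |p.1| ^ β * dx f p + ρ * dy f p)
      ((cabs.mul cx.continuousOn).add (continuousOn_const.mul cy.continuousOn))
      fun p hp => by simp [hx0 p hp, hy0 p hp]
    have hQ := mem (fun p => ρ * (|p.1| ^ β * dx f p) + dy f p)
      ((continuousOn_const.mul (cabs.mul cx.continuousOn)).add cy.continuousOn)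
      fun p hp => by simp [hx0 p hp, hy0 p hp]
    have hLm : MemLp (L f) 2 (weightedMeasure β ρ j) := by
      rw [hL f hf]
      exact (hH.add hV).const_mul (1 / 2)
    obtain ⟨R, hR⟩ := hKc.isBounded.subset_closedBall 0
    have hR1 : ∀ p : ℝ × ℝ, R + 1 ≤ |p.1| → p ∉ tsupport f := fun p hp hpK => by
      have h1 := (norm_fst_le p).trans (mem_closedBall_zero_iff.1 (hR hpK))
      rw [Real.norm_eq_abs] at h1
      linarith
    have hR2 : ∀ p : ℝ × ℝ, R + 1 ≤ |p.2| → p ∉ tsupport f := fun p hp hpK => by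
      have h1 := (norm_snd_le p).trans (mem_closedBall_zero_iff.1 (hR hpK))
      rw [Real.norm_eq_abs] at h1
      linarith
    obtain ⟨h, hA, hB, H⟩ := exists_hasGradient_of_contDiff hρ₀ hρ₁ hβ hf.smooth hf.compact hμ
    refine ⟨h, hLm, H.mem_formDomain hρ₀ hρ₁, fun v hv => ?_⟩
    obtain ⟨A', B', H'⟩ := exists_hasGradient hρ₀ hρ₁ hv
    have i1 : inner ℝ (hP.toLp _) A' = -inner ℝ (hH.toLp _) v := by
      refine H'.inner_horizontal hρ₀ hρ₁ hP hH (R := R + 1) (fun y x => ?_)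
        (cont _ (cW.mul cH) fun p hp => by rw [hH0 p hp, mul_zero]) fun p hp => ?_
      · by_cases hp : (x, y) ∈ tsupport f
        · exact hasDerivAt_horizontal_flux f hf.smooth (hf.support hp).1
        -- Off the support the flux vanishes near the point; this covers `x = 0`, where the powers
        -- may be singular.
        · rw [hH0 _ hp, mul_zero]
          refine (hasDerivAt_const x 0).congr_of_eventuallyEq ?_
          have hc : Continuous fun s : ℝ => (s, y) := by fun_prop
          filter_upwards [hc.continuousAt.preimage_mem_nhds (hcl.isOpen_compl.mem_nhds hp)]
            with s hs
          simp [hx0 _ hs, hy0 _ hs]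
      · simp [hx0 _ (hR1 p hp), hy0 _ (hR1 p hp), hH0 _ (hR1 p hp)]
    have i2 : inner ℝ (hQ.toLp _) B' = -inner ℝ (hV.toLp _) v := by
      refine H'.inner_vertical hρ₀ hρ₁ hQ hV (R := R + 1) (fun x y => ?_)
        (cont _ (cW.mul cV) fun p hp => by rw [hV0 p hp, mul_zero]) fun p hp => ?_
      · by_cases hp : (x, y) ∈ tsupport f
        · exact hasDerivAt_vertical_flux f hf.smooth (hf.support hp).1
        · rw [hV0 _ hp, mul_zero]
          refine (hasDerivAt_const y 0).congr_of_eventuallyEq ?_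
          have hc : Continuous fun s : ℝ => (x, s) := by fun_prop
          filter_upwards [hc.continuousAt.preimage_mem_nhds (hcl.isOpen_compl.mem_nhds hp)]
            with s hs
          simp [hx0 _ hs, hy0 _ hs]
      · simp [hx0 _ (hR2 p hp), hy0 _ (hR2 p hp), hV0 _ (hR2 p hp)]
    -- The fluxes are `P = A + ρ B` and `Q = ρ A + B`, so that `2 Ẽ(f, v) = (P, A') + (Q, B')`.
    have eP : hP.toLp _ = hA.toLp _ + ρ • hB.toLp _ := by
      rw [← MemLp.toLp_const_smul, ← MemLp.toLp_add]
      rfl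
    have eQ : hQ.toLp _ = ρ • hA.toLp _ + hB.toLp _ := by
      rw [← MemLp.toLp_const_smul, ← MemLp.toLp_add]
      rfl
    have eL : hLm.toLp (L f) = (1 / 2 : ℝ) • (hH.toLp _ + hV.toLp _) := by
      rw [← MemLp.toLp_add, ← MemLp.toLp_const_smul]
      exact MemLp.toLp_congr _ _ (by rw [hL f hf]; exact ae_eq_rfl)
    rw [eP, inner_add_left, real_inner_smul_left] at i1
    rw [eQ, inner_add_left, real_inner_smul_left] at i2
    rw [H.form_eq hρ₀ hρ₁ H', eL, real_inner_smul_left, inner_add_left]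
    linear_combination (1 / 2) * i1 + (1 / 2) * i2
  intro f₁ f₂ hf₁ hf₂
  obtain ⟨h₁, hL₁, hD₁, hform⟩ := key f₁ hf₁
  obtain ⟨h₂, -, hD₂, -⟩ := key f₂ hf₂
  obtain ⟨hdom, hgen⟩ := generator_eq hρ₀ hρ₁ hβ hD₁ hform
  refine ⟨h₁, h₂, hL₁, hdom, hgen, by rw [hgen], ?_⟩
  rw [hform _ hD₂, neg_neg]

end

end TimeChangedSABR

end

open TimeChangedSABR in
theorem mainTheorem5 (β ρ : ℝ) (hβ₀ : 0 ≤ β) (hβ₁ : β ≤ 1) (hρ₀ : -1 < ρ) (hρ₁ : ρ < 1) :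
    (∀ j : ℕ, (j = 0 ∧ β < 1) ∨ (j = 1 ∧ β < 1 / 2) →
      -- on test functions the form is given by the classical partial derivatives
      (∀ f₁ f₂ : ℝ × ℝ → ℝ, IsTestFunction Set.univ f₁ → IsTestFunction Set.univ f₂ →
        ∃ (h₁ : MemLp f₁ 2 (weightedMeasure β ρ j)) (h₂ : MemLp f₂ 2 (weightedMeasure β ρ j)),
          Integrable (fun p => coefForm β ρ p (dx f₁ p) (dy f₁ p) (dx f₂ p) (dy f₂ p))
            (weightedMeasure β ρ j) ∧
          form β ρ j (h₁.toLp f₁) (h₂.toLp f₂) =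
            (1 / 2) * ∫ p, coefForm β ρ p (dx f₁ p) (dy f₁ p) (dx f₂ p) (dy f₂ p)
              ∂(weightedMeasure β ρ j)) ∧
      IsSymmetricForm (form β ρ j) (testDomain β ρ j) ∧
      IsClosable (form β ρ j) (testDomain β ρ j) ∧
      IsDirichletForm (form β ρ j) (formDomain β ρ j)) ∧
    GeneratorMatches β ρ 0 (opLaplace β ρ) ∧
    (β = 0 → GeneratorMatches β ρ 0 (opA β ρ)) ∧
    (ρ = 0 → GeneratorMatches β ρ 1 (opA β ρ)) := by
  refine ⟨fun j hj => ?_, ?_, fun hβ => ?_, fun hρ => ?_⟩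
  -- The first bound makes the weight locally integrable, the second closes the gradient; the second
  -- exponent is `-β` for `j = 0` and `0` for `j = 1`.
  · have hs : β * (1 + j) < 1 ∧ -1 < β * (1 + j) - 2 * β := by
      rcases hj with ⟨rfl, h⟩ | ⟨rfl, h⟩
      · push_cast
        constructor <;> linarith
      · push_cast
        constructor <;> linarith
    have hd := isDirichletForm_formDomain hρ₀ hρ₁ hβ₀ hs.1 hs.2
    exact ⟨fun f₁ f₂ => form_eq_integral_coefForm hρ₀ hρ₁ hβ₀ hs.1,
      isSymmetricForm_testDomain hρ₀ hρ₁ hβ₀ hs.1,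
      ⟨_, _, hd.toIsClosedForm, testDomain_subset_formDomain hρ₀ hρ₁ hβ₀ hs.1,
        fun _ _ _ _ => rfl⟩, hd⟩
  -- For `j = 0` the flux leaves the drift `β x^{2β-1} ∂ₓ` and the mixed first-order term cancels.
  · refine generatorMatches_of_eq hρ₀ hρ₁ hβ₀ fun f hf => ?_
    funext p
    simp only [opLaplace, opA, horizontalOp, verticalOp, dx_dy_comm hf.smooth]
    push_cast
    ring
  · refine generatorMatches_of_eq hρ₀ hρ₁ hβ₀ fun f hf => ?_
    funext p
    simp only [opA, horizontalOp, verticalOp, dx_dy_comm hf.smooth, hβ]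
    push_cast
    ring
  -- For `j = 1` the `∂ₓ` drift cancels, and the remaining drift `-ρ β x^{β-1} ∂ᵧ` disappears for `ρ
  -- = 0`.
  · refine generatorMatches_of_eq hρ₀ hρ₁ hβ₀ fun f hf => ?_
    funext p
    simp only [opA, horizontalOp, verticalOp, dx_dy_comm hf.smooth, hρ]
    push_cast
    ring
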